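/- **Setting.** An $\omega$-continuous semiring is a (not necessarily commutative) semiring $(S,\oplus,\odot,0,1)$ with a partial order $\preceq$ in which every $\omega$-chain has a supremum, $0$ is the least element, and $\oplus,\odot$ are $\omega$-continuous in both arguments; a countable sum $\bigoplus_i s_i$ is the supremum of the partial sums along an enumeration, and $s^*=\bigoplus_{n}s^n$. It is *computable* if $S$ is (via an injective coding into $\mathbb N$) a computable set, $\oplus$, $\odot$ and $s\mapsto s^*$ are computable on codes, and $\preceq$ is decidable on codes. Fix finitely many fields $f_1,\dots,f_k$ and a finite set of values. A packet $\pi\in\mathsf{Pk}$ assigns a value to every field; a history $h=\pi{::}\hbar$ is a nonempty list of packets with head $\pi$. Predicates $t$ are Boolean combinations of tests $f=n$. Policies are $$p,q::= t\mid f\leftarrow n\mid \mathsf{dup}\mid p;q\mid s\odot p\ (s\in S)\mid p\oplus q\mid p^*,$$ with semantics $[\![p]\!](h)(h')\in S$, where $[P]$ is $1$ if $P$ holds and $0$ otherwise: $[\![t]\!](\pi{::}\hbar)(h')=[\pi\models t]\odot[h'=\pi{::}\hbar]$, $[\![f\leftarrow n]\!](\pi{::}\hbar)(h')=[h'=\pi[f:=n]{::}\hbar]$,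 $[\![\mathsf{dup}]\!](\pi{::}\hbar)(h')=[h'=\pi{::}\pi{::}\hbar]$, $[\![p;q]\!](h)(h')=\bigoplus_{h''}[\![p]\!](h)(h'')\odot[\![q]\!](h'')(h')$, $[\![s\odot p]\!]=s\odot[\![p]\!]$, $[\![p\oplus q]\!]=[\![p]\!]\oplus[\![q]\!]$, $[\![p^*]\!]=\bigoplus_{n\ge0}[\![p^{(n)}]\!]$ with $p^{(0)}=\mathsf{true}$, $p^{(n+1)}=p;p^{(n)}$. For $\pi\in\mathsf{Pk}$ let $\pi^?$ be the predicate $f_1=\pi.f_1\wedge\dots\wedge f_k=\pi.f_k$ and $\pi^!$ the policy $f_1\leftarrow\pi.f_1;\dots;f_k\leftarrow\pi.f_k$. *Reduced policies* are built from $\pi^?$, $\pi^!$, $\mathsf{dup}$ by $;$, $s\odot{}$, $\oplus$, ${}^*$. The reduction $\downarrow$ replaces a predicate $t$ by $\bigoplus_{\pi}[\pi\models t]\odot\pi^?$ and $f\leftarrow n$ by $\bigoplus_\pi \pi^?;(\pi[f:=n])^!$ (an empty choice being $0\odot\mathsf{dup}$), and commutes with the other constructs. A *wNetKAT automaton* has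 a finite state set $Q$, initial weights $\iota\in S^{Q}$ (a row), transition matrices $\delta_{\alpha\beta}\in S^{Q\times Q}$ and output columns $\lambda_{\alpha\beta}\in S^Q$ for packets $\alpha,\beta$; it assigns to a guarded string the weight $$[\![\mathcal A]\!](\pi_0\,\pi_1\,\mathsf{dup}\cdots\mathsf{dup}\,\pi_n)=\iota\times\delta_{\pi_0\pi_1}\times\cdots\times\delta_{\pi_{n-2}\pi_{n-1}}\times\lambda_{\pi_{n-1}\pi_n}\qquad(n\ge1).$$ The automaton $\mathcal A_p$ of a reduced policy $p$ is defined by recursion (writing $\iota_i,\delta^i,\lambda^i$ for the automaton of $p_i$ and using block notation): - $\pi^?$: one state, $\iota=1$, $\delta=0$, $\lambda_{\alpha\beta}=[\alpha=\beta=\pi]$; $\ \pi^!$: the same with $\lambda_{\alpha\beta}=[\beta=\pi]$; - $\mathsf{dup}$: two states $\heartsuit,\clubsuit$, with $\iota(\heartsuit)=1$, $\delta_{\alpha\beta}(\heartsuit,\clubsuit)=[\alpha=\beta]$, $\lambda_{\alpha\beta}(\clubsuit)=[\alpha=\beta]$ and all other weights $0$; - $s\odot p_1$: $\iota=s\odot\iota_1$,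 with $\delta^1$ and $\lambda^1$ unchanged; - $p_1\oplus p_2$: $\iota=(\iota_1,\iota_2)$, $\delta_{\alpha\beta}=\begin{pmatrix}\delta^1_{\alpha\beta}&0\\0&\delta^2_{\alpha\beta}\end{pmatrix}$, $\lambda_{\alpha\beta}=\begin{pmatrix}\lambda^1_{\alpha\beta}\\\lambda^2_{\alpha\beta}\end{pmatrix}$; - $p_1;p_2$: $\iota=(\iota_1,0)$, $\delta_{\alpha\beta}=\begin{pmatrix}\delta^1_{\alpha\beta}&\bigoplus_\gamma\lambda^1_{\alpha\gamma}\iota_2\delta^2_{\gamma\beta}\\0&\delta^2_{\alpha\beta}\end{pmatrix}$, $\lambda_{\alpha\beta}=\begin{pmatrix}\bigoplus_\gamma\lambda^1_{\alpha\gamma}\iota_2\lambda^2_{\gamma\beta}\\\lambda^2_{\alpha\beta}\end{pmatrix}$; - $p_1^*$: let $\Lambda=\bigoplus_{n}M^n$ for the $\mathsf{Pk}\times\mathsf{Pk}$ matrix $M_{\alpha\beta}=\iota_1\lambda^1_{\alpha\beta}$, and $\rho_{\alpha\beta}=\bigoplus_\gamma\Lambda_{\alpha\gamma}\iota_1\delta^1_{\gamma\beta}$;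 then $\iota=(0,1)$, $\delta_{\alpha\beta}=\begin{pmatrix}\delta^1_{\alpha\beta}\oplus\bigoplus_\gamma\lambda^1_{\alpha\gamma}\rho_{\gamma\beta}&0\\\rho_{\alpha\beta}&0\end{pmatrix}$, $\lambda_{\alpha\beta}=\begin{pmatrix}\bigoplus_\gamma\lambda^1_{\alpha\gamma}\Lambda_{\gamma\beta}\\\Lambda_{\alpha\beta}\end{pmatrix}$. Policies, histories, guarded strings and automata are coded by natural numbers in the standard effective way, relative to the coding of $S$. **Theorem (Computable semantics).** Let $S$ be a computable $\omega$-continuous semiring. Then the semantics of every policy is computable by compiling it to its automaton, uniformly in the policy: 1. the reduction $p\mapsto{\downarrow}p$ and, on reduced policies, the compilation $p\mapsto\mathcal A_p$ are computable; 2. $(\mathcal A,x)\mapsto[\![\mathcal A]\!](x)$ is computable, for automata $\mathcal A$ and guarded strings $x$; 3. $[\![{\downarrow}p]\!]=[\![p]\!]$ for every policy $p$; for every reduced policy $p$, all packets $\pi_0,\dots,\pi_n$ ($n\ge1$) and every list $\hbar$ of packets, $[\![p]\!](\pi_0{::}\hbar)(\pi_n{::}\cdots{::}\pi_1{::}\hbar)=[\![\mathcal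 A_p]\!](\pi_0\,\pi_1\,\mathsf{dup}\cdots\mathsf{dup}\,\pi_n)$; and for every policy $p$, $[\![p]\!](\pi{::}\hbar)(\pi'{::}\hbar')=0$ whenever $\hbar$ is not a suffix of $\hbar'$; 4. the map $(p,h,h')\mapsto[\![p]\!](h)(h')$, on all policies $p$ and histories $h,h'$, is computable. -/

import Mathlib

open Encodable OmegaCompletePartialOrder

namespace WNetKAT

/-! ### ω-continuous semirings and countable sums -/

/-- An `ω`-continuous semiring: a semiring that is an `ω`-complete partial order with least element
`0`, such that addition and multiplication are `ω`-continuous (in particular monotone) in both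
arguments. Multiplication need not be commutative. -/
class OmegaContinuousSemiring (S : Type*) extends Semiring S, OmegaCompletePartialOrder S where
  protected zero_le : ∀ s : S, 0 ≤ s
  add_continuous : ∀ s : S, ωScottContinuous (fun x : S => s + x)
  mul_left_continuous : ∀ s : S, ωScottContinuous (fun x : S => s * x)
  mul_right_continuous : ∀ s : S, ωScottContinuous (fun x : S => x * s)

section Sums

variable {S : Type*} [OmegaContinuousSemiring S]

/-- The sequence of partial sums of a sequence, as an `ω`-chain. -/
def partialSums (f : ℕ → S) : Chain S where
  toFun n := ∑ j ∈ Finset.range n, f j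
  monotone' := monotone_nat_of_le_succ fun n => by
    rw [Finset.sum_range_succ]
    simpa using (OmegaContinuousSemiring.add_continuous (∑ j ∈ Finset.range n, f j)).monotone
      (OmegaContinuousSemiring.zero_le (f n))

/-- The sum of a family over a countable index set: the supremum of the partial sums along an
enumeration of the index set (numbers that enumerate nothing contribute `0`). -/
def csum {I : Type*} [Encodable I] (f : I → S) : S :=
  ωSup (partialSums fun j => (decode₂ I j).elim 0 f)

/-- The star (closure) of a semiring element, `s* = ∑ₙ sⁿ`. -/
def sstar (s : S) : S := csum fun n : ℕ => s ^ n

/-- The star of a finite square matrix, `M* = ∑ₙ Mⁿ` (entrywise). -/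
def matStar {X : Type*} [Fintype X] [DecidableEq X] (M : Matrix X X S) : Matrix X X S :=
  Matrix.of fun x y => csum fun n : ℕ => (M ^ n) x y

end Sums

/-! ### Computability over coded types -/

/-- A function between coded types is computable if it is tracked on codes by a computable function
on `ℕ`. (Values of the tracking function outside the set of codes are irrelevant; when the set of
codes of `α` is computable, a partial recursive tracking function would be equivalent.) -/
def IsComputable {α β : Type*} [Encodable α] [Encodable β] (f : α → β) : Prop :=
  ∃ g : ℕ → ℕ, Computable g ∧ ∀ a, g (encode a) = encode (f a)

/-- A computable semiring: the domain is (via the coding) a computable set of natural numbers, the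
operations `+`, `*` and star are computable, and the order is decidable. -/
structure IsComputableSemiring (S : Type*) [OmegaContinuousSemiring S] [Encodable S] : Prop where
  domain : ComputablePred fun n : ℕ => ∃ s : S, encode s = n
  add : IsComputable fun x : S × S => x.1 + x.2
  mul : IsComputable fun x : S × S => x.1 * x.2
  star : IsComputable fun s : S => sstar s
  order : ComputablePred fun n : ℕ × ℕ => ∃ s t : S, encode s = n.1 ∧ encode t = n.2 ∧ s ≤ t

/-! ### Syntax -/

/-- A packet assigns to each of the `k` fields one of the `v` values. -/
abbrev Packet (k v : ℕ) : Type := Fin k → Fin v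

/-- A history is a nonempty list of packets, given by its head packet and its tail. -/
abbrev History (k v : ℕ) : Type := Packet k v × List (Packet k v)

/-- Predicates. -/
inductive Pred (k v : ℕ) : Type
  | ff : Pred k v
  | tt : Pred k v
  | test (f : Fin k) (n : Fin v) : Pred k v
  | or (t u : Pred k v) : Pred k v
  | and (t u : Pred k v) : Pred k v
  | not (t : Pred k v) : Pred k v

/-- Policies with weights in `S`. -/
inductive Policy (k v : ℕ) (S : Type*)
  | filter (t : Pred k v) : Policy k v S
  | assign (f : Fin k) (n : Fin v) : Policy k v S
  | dup : Policy k v S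
  | seq (p q : Policy k v S) : Policy k v S
  | weigh (s : S) (p : Policy k v S) : Policy k v S
  | choice (p q : Policy k v S) : Policy k v S
  | star (p : Policy k v S) : Policy k v S

/-- Reduced policies: filters and modifications are replaced by complete tests and complete
assignments. -/
inductive RPolicy (k v : ℕ) (S : Type*)
  | ctest (π : Packet k v) : RPolicy k v S
  | cassign (π : Packet k v) : RPolicy k v S
  | dup : RPolicy k v S
  | seq (p q : RPolicy k v S) : RPolicy k v S
  | weigh (s : S) (p : RPolicy k v S) : RPolicy k v S
  | choice (p q : RPolicy k v S) : RPolicy k v S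
  | star (p : RPolicy k v S) : RPolicy k v S

/-! ### Denotational semantics -/

/-- Satisfaction of a predicate by a packet. -/
def Pred.sem {k v : ℕ} : Pred k v → Packet k v → Bool
  | .ff, _ => false
  | .tt, _ => true
  | .test f n, π => decide (π f = n)
  | .or t u, π => t.sem π || u.sem π
  | .and t u, π => t.sem π && u.sem π
  | .not t, π => !(t.sem π)

section Semantics

variable {k v : ℕ} {S : Type*} [OmegaContinuousSemiring S]

/-- Iverson bracket. -/
def iverson (S : Type*) [OmegaContinuousSemiring S] (P : Prop) [Decidable P] : S :=
  if P then 1 else 0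

/-- Unit of the weighting monad. A weighting over a countable set `X` is a function `X → S`: its
support is automatically countable. -/
def eta {X : Type*} [DecidableEq X] (x : X) : X → S := fun y => iverson S (x = y)

/-- Bind of the weighting monad, over a countable set `X`. The indices outside the support of `m`
contribute `0` to the sum. -/
def bind {X Y : Type*} [Encodable X] (m : X → S) (f : X → Y → S) : Y → S :=
  fun y => csum fun x => m x * f x y

/-- The `n`-fold sequential composition of a denotation with itself. -/
def nfoldSem (d : History k v → History k v → S) : ℕ → History k v → History k v → S
  | 0 => eta
  | n + 1 => fun h => bind (d h) (nfoldSem d n)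

/-- Denotational semantics: `p.sem h h'` is the weight `p` assigns to the output history `h'` on
the input history `h`. -/
def Policy.sem : Policy k v S → History k v → History k v → S
  | .filter t => fun h h' => iverson S (t.sem h.1 = true) * eta h h'
  | .assign f n => fun h => eta (Function.update h.1 f n, h.2)
  | .dup => fun h => eta (h.1, h.1 :: h.2)
  | .seq p q => fun h => bind (p.sem h) q.sem
  | .weigh s p => fun h h' => s * p.sem h h'
  | .choice p q => fun h h' => p.sem h h' + q.sem h h'
  | .star p => fun h h' => csum fun n : ℕ => nfoldSem p.sem n h h'

/-- The `n`-fold sequencing of a policy: `p⁰ = skip` and `pⁿ⁺¹ = p ; pⁿ`. -/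
def Policy.nfold (p : Policy k v S) : ℕ → Policy k v S
  | 0 => .filter .tt
  | n + 1 => .seq p (p.nfold n)

theorem Policy.sem_nfold (p : Policy k v S) (n : ℕ) : (p.nfold n).sem = nfoldSem p.sem n := by
  induction n with
  | zero => funext h h'; simp [Policy.nfold, Policy.sem, nfoldSem, iverson, Pred.sem]
  | succ n ih => simp only [Policy.nfold, Policy.sem, nfoldSem, ih]

/-- Iteration is the countable sum of the `n`-fold sequencings. -/
theorem Policy.sem_star (p : Policy k v S) (h h' : History k v) :
    (Policy.star p).sem h h' = csum fun n : ℕ => (p.nfold n).sem h h' := by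
  simp only [Policy.sem_nfold, Policy.sem]

end Semantics

/-! ### Reduction to reduced policies -/

/-- `x₁ ∘ (x₂ ∘ (… ∘ xₙ))`, and `e` for the empty list. -/
def fold1 {α : Type*} (op : α → α → α) (e : α) : List α → α
  | [] => e
  | [x] => x
  | x :: y :: l => op x (fold1 op e (y :: l))

/-- The list of all packets, in a fixed order. -/
def packets (k v : ℕ) : List (Packet k v) :=
  List.ofFn fun i : Fin (v ^ k) => finFunctionFinEquiv.symm i

section Reduction

variable {k v : ℕ} {S : Type*} [OmegaContinuousSemiring S]

/-- The predicate `f₁ = π.f₁ ∧ … ∧ fₖ = π.fₖ`. -/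
def completeTest (π : Packet k v) : Pred k v :=
  fold1 .and .tt ((List.finRange k).map fun f => .test f (π f))

/-- The policy `f₁ ← π.f₁ ; … ; fₖ ← π.fₖ`. -/
def completeAssign (π : Packet k v) : Policy k v S :=
  fold1 .seq (.filter .tt) ((List.finRange k).map fun f => .assign f (π f))

/-- Reduced policies are policies. -/
def RPolicy.toPolicy : RPolicy k v S → Policy k v S
  | .ctest π => .filter (completeTest π)
  | .cassign π => completeAssign π
  | .dup => .dup
  | .seq p q => .seq p.toPolicy q.toPolicy
  | .weigh s p => .weigh s p.toPolicy
  | .choice p q => .choice p.toPolicy q.toPolicy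
  | .star p => .star p.toPolicy

/-- Finite choice of reduced policies; the empty choice is the policy `0 ⊙ dup`, which drops
everything (it arises only if there are no packets at all). -/
def RPolicy.sum (l : List (RPolicy k v S)) : RPolicy k v S :=
  fold1 .choice (.weigh 0 .dup) l

/-- The reduction map from policies to reduced policies. -/
def Policy.reduce : Policy k v S → RPolicy k v S
  | .filter t => RPolicy.sum ((packets k v).map fun π =>
      .weigh (iverson S (t.sem π = true)) (.ctest π))
  | .assign f n => RPolicy.sum ((packets k v).map fun π =>
      .seq (.ctest π) (.cassign (Function.update π f n)))
  | .dup => .dup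
  | .seq p q => .seq p.reduce q.reduce
  | .weigh s p => .weigh s p.reduce
  | .choice p q => .choice p.reduce q.reduce
  | .star p => .star p.reduce

end Reduction

/-! ### Automata -/

/-- The guarded string `π₀ π₁ dup π₂ dup … πₙ₋₁ dup πₙ` (`n ≥ 1`) is represented by the triple
`(π₀, [π₁, …, πₙ₋₁], πₙ)`. -/
abbrev GuardedString (k v : ℕ) : Type := Packet k v × List (Packet k v) × Packet k v

/-- A wNetKAT automaton, with state set `{0, …, n - 1}`. -/
structure WNKA (k v : ℕ) (S : Type*) where
  n : ℕ
  init : Fin n → S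
  trans : Packet k v → Packet k v → Matrix (Fin n) (Fin n) S
  out : Packet k v → Packet k v → Fin n → S

section Automata

variable {k v : ℕ} {S : Type*} [OmegaContinuousSemiring S]

open Matrix

/-- `r × trans π₀ π₁ × trans π₁ π₂ × ⋯ × trans πₙ₋₂ πₙ₋₁ × out πₙ₋₁ πₙ`, for a row vector `r` and
the guarded string given by `π₀`, `[π₁, …, πₙ₋₁]`, `πₙ`. -/
def WNKA.run (A : WNKA k v S) (r : Fin A.n → S) (π : Packet k v) :
    List (Packet k v) → Packet k v → S
  | [], β => r ⬝ᵥ A.out π β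
  | γ :: l, β => A.run (r ᵥ* A.trans π γ) γ l β

/-- The weight that an automaton assigns to a guarded string. -/
def WNKA.sem (A : WNKA k v S) (x : GuardedString k v) : S := A.run A.init x.1 x.2.1 x.2.2

/-- The block matrix with the given quadrants. -/
def block {m n : ℕ} (a : Matrix (Fin m) (Fin m) S) (b : Matrix (Fin m) (Fin n) S)
    (c : Matrix (Fin n) (Fin m) S) (d : Matrix (Fin n) (Fin n) S) :
    Matrix (Fin (m + n)) (Fin (m + n)) S :=
  Matrix.reindex finSumFinEquiv finSumFinEquiv (Matrix.fromBlocks a b c d)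

/-- Automaton of a complete test. -/
def WNKA.ctest (π : Packet k v) : WNKA k v S where
  n := 1
  init := fun _ => 1
  trans := fun _ _ => 0
  out := fun α β _ => iverson S (α = β ∧ β = π)

/-- Automaton of a complete assignment. -/
def WNKA.cassign (π : Packet k v) : WNKA k v S where
  n := 1
  init := fun _ => 1
  trans := fun _ _ => 0
  out := fun _ β _ => iverson S (β = π)

/-- Automaton of `dup`: state `0` is initial, state `1` is reached by consuming a `dup`. -/
def WNKA.dup : WNKA k v S where
  n := 2
  init := fun q => iverson S (q = 0)
  trans := fun α β => Matrix.of fun q q' => iverson S (q = 0 ∧ q' = 1 ∧ α = β)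
  out := fun α β q => iverson S (q = 1 ∧ α = β)

/-- Automaton of a weighted policy. -/
def WNKA.weigh (s : S) (A : WNKA k v S) : WNKA k v S where
  n := A.n
  init := fun q => s * A.init q
  trans := A.trans
  out := A.out

/-- Automaton of a choice. -/
def WNKA.choice (A B : WNKA k v S) : WNKA k v S where
  n := A.n + B.n
  init := Fin.append A.init B.init
  trans := fun α β => block (A.trans α β) 0 0 (B.trans α β)
  out := fun α β => Fin.append (A.out α β) (B.out α β)

/-- Automaton of a sequential composition. -/
def WNKA.seq (A B : WNKA k v S) : WNKA k v S where
  n := A.n + B.n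
  init := Fin.append A.init 0
  trans := fun α β =>
    block (A.trans α β)
      (∑ γ : Packet k v, Matrix.vecMulVec (A.out α γ) (B.init ᵥ* B.trans γ β))
      0 (B.trans α β)
  out := fun α β =>
    Fin.append (fun q => ∑ γ : Packet k v, A.out α γ q * (B.init ⬝ᵥ B.out γ β)) (B.out α β)

/-- The output weights of the new initial state of an iteration: the star of the square matrix
`(α, β) ↦ init × out α β`, indexed by packets. -/
def WNKA.heartOut (A : WNKA k v S) : Matrix (Packet k v) (Packet k v) S :=
  matStar (Matrix.of fun α β => A.init ⬝ᵥ A.out α β)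

/-- The row vector `(heartOut × init × trans)_{αβ}`: the transitions of the new initial state. -/
def WNKA.heartTrans (A : WNKA k v S) (α β : Packet k v) : Fin A.n → S :=
  fun q => ∑ γ : Packet k v, A.heartOut α γ * (A.init ᵥ* A.trans γ β) q

/-- Automaton of an iteration; the new initial state is the last one. -/
def WNKA.star (A : WNKA k v S) : WNKA k v S where
  n := A.n + 1
  init := Fin.append 0 (fun _ => 1)
  trans := fun α β =>
    block
      (A.trans α β + ∑ γ : Packet k v, Matrix.vecMulVec (A.out α γ) (A.heartTrans γ β)) 0
      (Matrix.of fun _ q => A.heartTrans α β q) 0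
  out := fun α β =>
    Fin.append (fun q => ∑ γ : Packet k v, A.out α γ q * A.heartOut γ β)
      (fun _ => A.heartOut α β)

/-- The Thompson construction: the automaton of a reduced policy. -/
def RPolicy.thompson : RPolicy k v S → WNKA k v S
  | .ctest π => WNKA.ctest π
  | .cassign π => WNKA.cassign π
  | .dup => WNKA.dup
  | .seq p q => WNKA.seq p.thompson q.thompson
  | .weigh s p => WNKA.weigh s p.thompson
  | .choice p q => WNKA.choice p.thompson q.thompson
  | .star p => WNKA.star p.thompson

end Automata

/-! ### Codes of syntax and of automata -/

section Codes

variable {k v : ℕ} {S : Type*} [Encodable S]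

/-- Gödel number of a predicate. -/
def Pred.code : Pred k v → ℕ
  | .ff => Nat.pair 0 0
  | .tt => Nat.pair 1 0
  | .test f n => Nat.pair 2 (Nat.pair f n)
  | .or t u => Nat.pair 3 (Nat.pair t.code u.code)
  | .and t u => Nat.pair 4 (Nat.pair t.code u.code)
  | .not t => Nat.pair 5 t.code

theorem Pred.code_injective : Function.Injective (Pred.code (k := k) (v := v)) := by
  intro t
  induction t with
  | ff | tt => intro u h; cases u <;> simp_all [Pred.code, Nat.pair_eq_pair]
  | test f n => intro u h; cases u <;> simp_all [Pred.code, Nat.pair_eq_pair, Fin.ext_iff]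
  | or a b iha ihb | and a b iha ihb =>
    intro u h
    cases u <;> simp [Pred.code, Nat.pair_eq_pair] at h
    rw [iha h.1, ihb h.2]
  | not a iha =>
    intro u h
    cases u <;> simp [Pred.code, Nat.pair_eq_pair] at h
    rw [iha h]

/-- Gödel number of a policy. -/
def Policy.code : Policy k v S → ℕ
  | .filter t => Nat.pair 0 t.code
  | .assign f n => Nat.pair 1 (Nat.pair f n)
  | .dup => Nat.pair 2 0
  | .seq p q => Nat.pair 3 (Nat.pair p.code q.code)
  | .weigh s p => Nat.pair 4 (Nat.pair (encode s) p.code)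
  | .choice p q => Nat.pair 5 (Nat.pair p.code q.code)
  | .star p => Nat.pair 6 p.code

theorem Policy.code_injective : Function.Injective (Policy.code (k := k) (v := v) (S := S)) := by
  intro p
  induction p with
  | filter t =>
    intro u h
    cases u <;> simp [Policy.code, Nat.pair_eq_pair] at h
    rw [Pred.code_injective h]
  | assign f n => intro u h; cases u <;> simp_all [Policy.code, Nat.pair_eq_pair, Fin.ext_iff]
  | dup => intro u h; cases u <;> simp_all [Policy.code, Nat.pair_eq_pair]
  | seq a b iha ihb | choice a b iha ihb =>
    intro u h
    cases u <;> simp [Policy.code, Nat.pair_eq_pair] at h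
    rw [iha h.1, ihb h.2]
  | weigh s a iha =>
    intro u h
    cases u <;> simp [Policy.code, Nat.pair_eq_pair] at h
    rw [h.1, iha h.2]
  | star a iha =>
    intro u h
    cases u <;> simp [Policy.code, Nat.pair_eq_pair] at h
    rw [iha h]

/-- Gödel number of a reduced policy. -/
def RPolicy.code : RPolicy k v S → ℕ
  | .ctest π => Nat.pair 0 (encode π)
  | .cassign π => Nat.pair 1 (encode π)
  | .dup => Nat.pair 2 0
  | .seq p q => Nat.pair 3 (Nat.pair p.code q.code)
  | .weigh s p => Nat.pair 4 (Nat.pair (encode s) p.code)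
  | .choice p q => Nat.pair 5 (Nat.pair p.code q.code)
  | .star p => Nat.pair 6 p.code

theorem RPolicy.code_injective : Function.Injective (RPolicy.code (k := k) (v := v) (S := S)) := by
  intro p
  induction p with
  | ctest π | cassign π =>
    intro u h
    cases u <;> simp [RPolicy.code, Nat.pair_eq_pair] at h
    rw [h]
  | dup => intro u h; cases u <;> simp_all [RPolicy.code, Nat.pair_eq_pair]
  | seq a b iha ihb | choice a b iha ihb =>
    intro u h
    cases u <;> simp [RPolicy.code, Nat.pair_eq_pair] at h
    rw [iha h.1, ihb h.2]
  | weigh s a iha =>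
    intro u h
    cases u <;> simp [RPolicy.code, Nat.pair_eq_pair] at h
    rw [h.1, iha h.2]
  | star a iha =>
    intro u h
    cases u <;> simp [RPolicy.code, Nat.pair_eq_pair] at h
    rw [iha h]

/-- The list of the entries of a table indexed by packets. -/
def packetTable {α : Type*} (f : Packet k v → α) : List α :=
  List.ofFn fun i : Fin (v ^ k) => f (finFunctionFinEquiv.symm i)

theorem packetTable_injective {α : Type*} :
    Function.Injective (packetTable (k := k) (v := v) (α := α)) := by
  intro f g h
  funext π
  have := congrFun (List.ofFn_injective h) (finFunctionFinEquiv π)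
  simpa using this

/-- An automaton as finite data: the number of states and the lists of all weights. -/
def WNKA.data {S : Type*} (A : WNKA k v S) :
    ℕ × List S × List (List (List (List S))) × List (List (List S)) :=
  (A.n, List.ofFn A.init,
    packetTable fun α => packetTable fun β =>
      List.ofFn fun q => List.ofFn fun q' => A.trans α β q q',
    packetTable fun α => packetTable fun β => List.ofFn (A.out α β))

theorem WNKA.data_injective {S : Type*} :
    Function.Injective (WNKA.data (k := k) (v := v) (S := S)) := by
  rintro ⟨n, i, t, o⟩ ⟨n', i', t', o'⟩ h
  simp only [WNKA.data, Prod.mk.injEq] at h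
  obtain ⟨rfl, hi, ht, ho⟩ := h
  obtain rfl := List.ofFn_injective hi
  have ht' : t = t' := by
    funext α β q q'
    have h1 := congrFun (packetTable_injective (congrFun (packetTable_injective ht) α)) β
    exact congrFun (List.ofFn_injective (congrFun (List.ofFn_injective h1) q)) q'
  have ho' : o = o' := by
    funext α β
    exact List.ofFn_injective
      (congrFun (packetTable_injective (congrFun (packetTable_injective ho) α)) β)
  rw [ht', ho']

/-- Policies are coded by their Gödel numbers. -/
noncomputable instance : Encodable (Policy k v S) := Encodable.ofInj _ Policy.code_injective

/-- Reduced policies are coded by their Gödel numbers. -/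
noncomputable instance : Encodable (RPolicy k v S) := Encodable.ofInj _ RPolicy.code_injective

/-- Automata are coded by the code of their data. -/
noncomputable instance : Encodable (WNKA k v S) := Encodable.ofInj _ WNKA.data_injective

theorem encode_policy (p : Policy k v S) : encode p = p.code := rfl

theorem encode_rpolicy (p : RPolicy k v S) : encode p = p.code := rfl

theorem encode_wnka (A : WNKA k v S) : encode A = encode A.data := rfl

end Codes

end WNetKAT

namespace WNetKAT

section Sums

variable {S : Type*} [OmegaContinuousSemiring S]

theorem add_le_add' {a b c d : S} (h : a ≤ b) (h' : c ≤ d) : a + c ≤ b + d := by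
  have h1 := (OmegaContinuousSemiring.add_continuous a).monotone h'
  have h2 := (OmegaContinuousSemiring.add_continuous d).monotone h
  simp only [add_comm d] at h2
  exact h1.trans h2

theorem mul_le_mul_left'' (a : S) {b c : S} (h : b ≤ c) : a * b ≤ a * c :=
  (OmegaContinuousSemiring.mul_left_continuous a).monotone h

theorem zero_le' (a : S) : 0 ≤ a := OmegaContinuousSemiring.zero_le a

instance : AddLeftMono S := ⟨fun _ _ _ h => add_le_add' le_rfl h⟩

theorem sum_le_sum_of_subset'' {I : Type*} {s t : Finset I} (h : s ⊆ t) (f : I → S) :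
    ∑ i ∈ s, f i ≤ ∑ i ∈ t, f i :=
  Finset.sum_le_sum_of_subset_of_nonneg h fun i _ _ => zero_le' (f i)

variable {I J : Type*} [Encodable I] [Encodable J]

theorem exists_finset_partialSums (f : I → S) (n : ℕ) :
    ∃ s : Finset I, (∀ i ∈ s, encode i < n) ∧
      partialSums (fun j => (decode₂ I j).elim 0 f) n = ∑ i ∈ s, f i := by
  change ∃ s : Finset I, _ ∧ ∑ j ∈ Finset.range n, _ = _
  classical
  induction n with
  | zero => exact ⟨∅, by simp⟩
  | succ n ih =>
    obtain ⟨s, hs, hs'⟩ := ih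
    rw [Finset.sum_range_succ, hs']
    cases h : decode₂ I n with
    | none => exact ⟨s, fun i hi => (hs i hi).trans n.lt_succ_self, by simp⟩
    | some i =>
      have hi := decode₂_eq_some.1 h
      refine ⟨insert i s, fun j hj => ?_, ?_⟩
      · rcases Finset.mem_insert.1 hj with rfl | hj
        · omega
        · exact (hs j hj).trans n.lt_succ_self
      · rw [Finset.sum_insert fun hm => (hs i hm).ne hi, add_comm]
        rfl

theorem sum_le_csum (f : I → S) (s : Finset I) : ∑ i ∈ s, f i ≤ csum f := by
  classical
  refine le_ωSup_of_le (s.sup encode + 1) ?_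
  change _ ≤ ∑ j ∈ Finset.range _, _
  calc ∑ i ∈ s, f i = ∑ j ∈ s.image encode, (decode₂ I j).elim 0 f := by
        rw [Finset.sum_image fun a _ b _ h => encode_injective h]
        simp
    _ ≤ _ := by
        refine sum_le_sum_of_subset'' (fun j hj => ?_) _
        obtain ⟨i, hi, rfl⟩ := Finset.mem_image.1 hj
        exact Finset.mem_range.2 (Nat.lt_succ_of_le (Finset.le_sup (f := encode) hi))

theorem csum_le {f : I → S} {b : S} (h : ∀ s : Finset I, ∑ i ∈ s, f i ≤ b) : csum f ≤ b := by
  refine ωSup_le _ _ fun n => ?_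
  obtain ⟨s, -, hs⟩ := exists_finset_partialSums f n
  exact hs ▸ h s

theorem csum_nat_le {f : ℕ → S} {b : S} (h : ∀ n, ∑ i ∈ Finset.range n, f i ≤ b) : csum f ≤ b :=
  csum_le fun _ => (sum_le_sum_of_subset'' (fun _ hi => Finset.mem_range.2
    (Nat.lt_succ_of_le (Finset.le_sup (f := id) hi))) f).trans (h _)

theorem csum_eq_sum {f : I → S} (s : Finset I) (h : ∀ i, i ∉ s → f i = 0) :
    csum f = ∑ i ∈ s, f i := by
  classical
  refine le_antisymm (csum_le fun t => ?_) (sum_le_csum f s)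
  rw [← Finset.sum_subset (Finset.inter_subset_left : t ∩ s ⊆ t)]
  · exact sum_le_sum_of_subset'' Finset.inter_subset_right f
  · intro i hi hi'
    exact h i fun hs => hi' (Finset.mem_inter.2 ⟨hi, hs⟩)

theorem csum_eq_single {f : I → S} (i : I) (h : ∀ j, j ≠ i → f j = 0) : csum f = f i := by
  rw [csum_eq_sum {i} fun j hj => h j (by simpa using hj), Finset.sum_singleton]

@[simp] theorem csum_zero : csum (fun _ : I => (0 : S)) = 0 := by
  rw [csum_eq_sum ∅ (by simp), Finset.sum_empty]

theorem map_csum {F : S → S} (hF : ωScottContinuous F) (h0 : F 0 = 0)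
    (hadd : ∀ a b, F (a + b) = F a + F b) (f : I → S) : F (csum f) = csum fun i => F (f i) := by
  unfold csum
  rw [hF.map_ωSup]
  congr 1
  ext n
  change F (∑ j ∈ Finset.range n, _) = ∑ j ∈ Finset.range n, _
  induction n with
  | zero => simpa using h0
  | succ n ih =>
    rw [Finset.sum_range_succ, Finset.sum_range_succ, hadd, ih]
    congr 1
    cases decode₂ I n <;> simp [h0]

theorem mul_csum (a : S) (f : I → S) : a * csum f = csum fun i => a * f i :=
  map_csum (OmegaContinuousSemiring.mul_left_continuous a) (mul_zero a) (mul_add a) f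

theorem csum_mul (f : I → S) (a : S) : csum f * a = csum fun i => f i * a :=
  map_csum (OmegaContinuousSemiring.mul_right_continuous a) (zero_mul a)
    (fun b c => add_mul b c a) f

theorem add_ωSup (a : S) (c : Chain S) {b : S} (h : ∀ n, a + c n ≤ b) : a + ωSup c ≤ b := by
  have := (OmegaContinuousSemiring.add_continuous a).map_ωSup c
  exact this ▸ ωSup_le _ _ h

theorem csum_add (f g : I → S) : csum (fun i => f i + g i) = csum f + csum g := by
  classical
  refine le_antisymm (csum_le fun s => ?_) ?_
  · rw [Finset.sum_add_distrib]
    exact add_le_add' (sum_le_csum f s) (sum_le_csum g s)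
  · refine add_ωSup _ _ fun n => ?_
    rw [add_comm]
    refine add_ωSup _ _ fun m => ?_
    obtain ⟨s, -, hs⟩ := exists_finset_partialSums g n
    obtain ⟨t, -, ht⟩ := exists_finset_partialSums f m
    rw [hs, ht]
    refine le_trans ?_ (sum_le_csum _ (s ∪ t))
    rw [Finset.sum_add_distrib, add_comm]
    exact add_le_add' (sum_le_sum_of_subset'' Finset.subset_union_right f)
      (sum_le_sum_of_subset'' Finset.subset_union_left g)

theorem csum_sum {K : Type*} (s : Finset K) (f : I → K → S) :
    csum (fun i => ∑ j ∈ s, f i j) = ∑ j ∈ s, csum fun i => f i j := by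
  classical
  induction s using Finset.induction_on with
  | empty => simp
  | insert a s ha ih => simp only [Finset.sum_insert ha, csum_add, ih]

theorem csum_succ (f : ℕ → S) : csum f = f 0 + csum fun n => f (n + 1) := by
  refine le_antisymm (csum_nat_le fun n => ?_) ?_
  · refine (sum_le_sum_of_subset'' (Finset.range_subset_range.2 n.le_succ) f).trans ?_
    rw [Finset.sum_range_succ', add_comm]
    exact add_le_add' le_rfl (sum_le_csum (fun n => f (n + 1)) _)
  · refine add_ωSup _ _ fun n => ?_
    change f 0 + ∑ j ∈ Finset.range n, (decode₂ ℕ j).elim 0 (fun n => f (n + 1)) ≤ _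
    have : ∀ j, (decode₂ ℕ j).elim 0 (fun n => f (n + 1)) = f (j + 1) := fun j => by
      rw [show decode₂ ℕ j = some j from decode₂_encode j]; rfl
    simp only [this]
    rw [add_comm, ← Finset.sum_range_succ']
    exact sum_le_csum f _

end Sums

section Stars

variable {S : Type*} [OmegaContinuousSemiring S]

theorem sstar_eq (c : S) : sstar c = 1 + c * sstar c := by
  unfold sstar
  rw [mul_csum]
  conv_lhs => rw [csum_succ]
  simp only [pow_zero, pow_succ']

theorem sstar_mul_le {c b x : S} (h : b + c * x ≤ x) : sstar c * b ≤ x := by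
  unfold sstar
  rw [csum_mul]
  refine csum_nat_le fun n => ?_
  induction n with
  | zero => simpa using zero_le' x
  | succ n ih =>
    rw [Finset.sum_range_succ', add_comm]
    refine le_trans ?_ h
    simp only [pow_succ', mul_assoc, ← Finset.mul_sum, pow_zero, one_mul]
    exact add_le_add' le_rfl (mul_le_mul_left'' c ih)

theorem matrix_mul_mono {X Y : Type*} [Fintype X] (M : Matrix X X S)
    {A B : Matrix X Y S} (h : ∀ i j, A i j ≤ B i j)
    (i : X) (j : Y) : (M * A) i j ≤ (M * B) i j :=
  Finset.sum_le_sum fun a _ => mul_le_mul_left'' _ (h a j)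

variable {X Y : Type*} [Fintype X] [DecidableEq X]

theorem matStar_apply (M : Matrix X X S) (i j : X) :
    matStar M i j = csum fun n : ℕ => (M ^ n) i j := rfl

theorem matStar_eq (M : Matrix X X S) : matStar M = 1 + M * matStar M := by
  ext i j
  rw [Matrix.add_apply, Matrix.mul_apply, matStar_apply, csum_succ]
  simp only [pow_zero, matStar_apply, mul_csum, ← csum_sum, pow_succ', Matrix.mul_apply]

theorem matStar_mul_apply (M : Matrix X X S) (B : Matrix X Y S) (i : X) (j : Y) :
    (matStar M * B) i j = csum fun n : ℕ => (M ^ n * B) i j := by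
  simp only [Matrix.mul_apply, matStar_apply, csum_mul, ← csum_sum]

theorem matStar_mul_le {M : Matrix X X S} {B Z : Matrix X Y S}
    (h : ∀ i j, (B + M * Z) i j ≤ Z i j) (i : X) (j : Y) : (matStar M * B) i j ≤ Z i j := by
  rw [matStar_mul_apply]
  refine csum_nat_le fun n => ?_
  induction n generalizing i j with
  | zero => simpa using zero_le' _
  | succ n ih =>
    rw [Finset.sum_range_succ', add_comm]
    refine le_trans ?_ (h i j)
    rw [Matrix.add_apply, pow_zero, Matrix.one_mul]
    refine add_le_add' le_rfl (le_trans (le_of_eq ?_)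
      (matrix_mul_mono M (A := ∑ m ∈ Finset.range n, M ^ m * B) (fun i j => ?_) i j))
    · simp only [Matrix.mul_sum, pow_succ', Matrix.mul_assoc, Matrix.sum_apply]
    · rw [Matrix.sum_apply]
      exact ih i j

@[simp] theorem matStar_zero : matStar (0 : Matrix X X S) = 1 := by
  rw [matStar_eq, zero_mul, add_zero]

/-- The star of a matrix after adding a row vector to one of its rows. -/
theorem matStar_add_row (A : Matrix X X S) (k : X) (r : X → S) (i j : X) :
    matStar (A + Matrix.of fun i j => if i = k then r j else 0) i j =
      matStar A i j + matStar A i k *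
        (sstar (∑ a, r a * matStar A a k) * ∑ a, r a * matStar A a j) := by
  set M := A + Matrix.of fun i j => if i = k then r j else 0 with hM
  have hmul : ∀ Z : Matrix X X S, ∀ i j,
      (M * Z) i j = (A * Z) i j + if i = k then ∑ a, r a * Z a j else 0 := by
    intro Z i j
    rw [hM, Matrix.add_mul, Matrix.add_apply]
    congr 1
    by_cases h : i = k <;> simp [Matrix.mul_apply, h]
  set c := ∑ a, r a * matStar A a k with hc
  set u : X → S := fun j => ∑ a, r a * matStar A a j with hu
  have hsum : ∀ (y : X → S) (j : X),
      ∑ a, r a * (matStar A a j + matStar A a k * y j) = u j + c * y j := by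
    intro y j
    simp only [mul_add, Finset.sum_add_distrib, ← mul_assoc, ← Finset.sum_mul, hu, hc]
  refine le_antisymm ?_ ?_
  · let N : Matrix X X S := Matrix.of fun i j => matStar A i j + matStar A i k * (sstar c * u j)
    have key : ∀ i j, (1 + M * N) i j ≤ N i j := by
      intro i j
      refine le_of_eq ?_
      have hA : ∀ i j, matStar A i j = (1 : Matrix X X S) i j + (A * matStar A) i j := fun i j => by
        conv_lhs => rw [matStar_eq]
        rfl
      have hz : u j + c * (sstar c * u j) = sstar c * u j := by
        conv_rhs => rw [sstar_eq]
        rw [add_mul, one_mul, mul_assoc]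
      have hAN : (A * N) i j = (A * matStar A) i j + (A * matStar A) i k * (sstar c * u j) := by
        simp only [Matrix.mul_apply, N, Matrix.of_apply, mul_add, Finset.sum_add_distrib,
          Finset.sum_mul, mul_assoc]
      rw [Matrix.add_apply, hmul, hAN]
      simp only [N, Matrix.of_apply]
      rw [hsum (fun j => sstar c * u j) j, hz, hA i j, hA i k, add_mul,
        Matrix.one_apply (i := i) (j := k)]
      by_cases h : i = k <;> simp [h] <;> abel
    have := matStar_mul_le key i j
    rwa [Matrix.mul_one] at this
  · set Z := matStar M with hZ
    have hZe : ∀ i j, Z i j = (1 : Matrix X X S) i j + (M * Z) i j := fun i j => by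
      conv_lhs => rw [hZ, matStar_eq]
      rfl
    let y : X → S := fun j => ∑ a, r a * Z a j
    have h1 : ∀ i j, matStar A i j + matStar A i k * y j ≤ Z i j := by
      intro i j
      let B : Matrix X X S := 1 + Matrix.of fun i j => if i = k then y j else 0
      have := matStar_mul_le (M := A) (B := B) (Z := Z) (fun i j => le_of_eq (by
        rw [hZe i j, hmul]
        simp only [B, Matrix.add_apply, Matrix.of_apply, y]
        abel)) i j
      refine le_trans (le_of_eq ?_) this
      simp only [B, Matrix.mul_add, Matrix.add_apply, Matrix.mul_one]
      congr 1
      simp [Matrix.mul_apply]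
    have h2 : sstar c * u j ≤ y j := by
      refine sstar_mul_le ?_
      rw [← hsum]
      exact Finset.sum_le_sum fun a _ => mul_le_mul_left'' _ (h1 a j)
    exact (add_le_add' le_rfl (mul_le_mul_left'' _ h2)).trans (h1 i j)

/-- The sum of a sequence of matrices given by an affine recursion. -/
theorem csum_affine_recursion {M : Matrix X X S} {x y : ℕ → Matrix X Y S} (h0 : x 0 = 0)
    (h : ∀ n, x (n + 1) = M * x n + y n) (i : X) (j : Y) :
    (csum fun n => x n i j) = (matStar M * Matrix.of fun i j => csum fun n => y n i j) i j := by
  set W : Matrix X Y S := Matrix.of fun i j => csum fun n => y n i j with hW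
  refine le_antisymm ?_ ?_
  · refine csum_nat_le fun n => ?_
    have key : ∀ n i j, ∑ m ∈ Finset.range n, x m i j ≤ (matStar M * W) i j := by
      intro n
      induction n with
      | zero => intro i j; simpa using zero_le' _
      | succ n ih =>
        intro i j
        rw [Finset.sum_range_succ', h0, Matrix.zero_apply, add_zero]
        simp only [h, Matrix.add_apply, Finset.sum_add_distrib]
        rw [matStar_eq, Matrix.add_mul, Matrix.one_mul, Matrix.add_apply, add_comm,
          Matrix.mul_assoc]
        refine add_le_add' (sum_le_csum (fun n => y n i j) _) (le_trans (le_of_eq ?_)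
          (matrix_mul_mono M (A := ∑ m ∈ Finset.range n, x m) (fun i j => ?_) i j))
        · simp only [Matrix.mul_sum, Matrix.sum_apply]
        · rw [Matrix.sum_apply]
          exact ih i j
    exact key n i j
  · refine matStar_mul_le (Z := Matrix.of fun i j => csum fun n => x n i j) (fun i j => ?_) i j
    refine le_of_eq ?_
    simp only [Matrix.add_apply, Matrix.of_apply, Matrix.mul_apply, hW]
    conv_rhs => rw [csum_succ, h0, Matrix.zero_apply, zero_add]
    simp only [h, Matrix.add_apply, csum_add, Matrix.mul_apply, mul_csum, csum_sum]
    rw [add_comm]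

end Stars

section Series

open Matrix

variable {S : Type*} [OmegaContinuousSemiring S] {P : Type*} [Fintype P]

/-- Convolution of a row vector of formal power series over guarded strings with a series `G`. -/
def conv (G : P → List P → P → S) : (List P → P → S) → List P → P → S
  | F, [], β => ∑ γ, F [] γ * G γ [] β
  | F, c :: l, β => ∑ γ, F [] γ * G γ (c :: l) β + conv G (fun l => F (c :: l)) l β

theorem conv_eq (G : P → List P → P → S) (F : List P → P → S) (l : List P) (β : P) :
    conv G F l β =
      ∑ i ∈ Finset.range (l.length + 1), ∑ γ, F (l.take i) γ * G γ (l.drop i) β := by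
  induction l generalizing F with
  | nil => simp [conv]
  | cons c l ih =>
    rw [conv, ih, List.length_cons, Finset.sum_range_succ' _ (l.length + 1), add_comm]
    simp

theorem conv_isLinearMap (G : P → List P → P → S) (l : List P) (β : P) :
    IsLinearMap S fun F : List P → P → S => conv G F l β where
  map_add F F' := by
    simp only [conv_eq, Pi.add_apply, add_mul, Finset.sum_add_distrib]
  map_smul s F := by
    simp only [conv_eq, Pi.smul_apply, smul_eq_mul, mul_assoc, Finset.mul_sum]

theorem conv_csum (G : ℕ → P → List P → P → S) (F : List P → P → S) (l : List P) (β : P) :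
    (csum fun n => conv (G n) F l β) = conv (fun α l β => csum fun n => G n α l β) F l β := by
  simp only [conv_eq, csum_sum, mul_csum]

variable [DecidableEq P]

/-- The powers of a formal power series over guarded strings. -/
def seriesPow (F : P → List P → P → S) : ℕ → P → List P → P → S
  | 0 => fun α l β => if l = [] ∧ α = β then 1 else 0
  | n + 1 => fun α => conv (seriesPow F n) (F α)

/-- The star of a formal power series over guarded strings. -/
def seriesStar (F : P → List P → P → S) (α : P) (l : List P) (β : P) : S :=
  csum fun n => seriesPow F n α l β

theorem seriesStar_nil (F : P → List P → P → S) (α β : P) :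
    seriesStar F α [] β = matStar (Matrix.of fun α β => F α [] β) α β := by
  rw [matStar_apply]
  refine congrArg csum (funext fun n => ?_)
  induction n generalizing α with
  | zero => simp [seriesPow, Matrix.one_apply]
  | succ n ih => simp only [seriesPow, conv, ih, pow_succ', Matrix.mul_apply, Matrix.of_apply]

theorem seriesStar_cons (F : P → List P → P → S) (α c β : P) (l : List P) :
    seriesStar F α (c :: l) β = ∑ γ, matStar (Matrix.of fun α β => F α [] β) α γ *
      conv (seriesStar F) (fun l => F γ (c :: l)) l β := by
  have := csum_affine_recursion (M := Matrix.of fun α β => F α [] β)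
    (x := fun n => Matrix.of fun α β => seriesPow F n α (c :: l) β)
    (y := fun n => Matrix.of fun α β => conv (seriesPow F n) (fun l => F α (c :: l)) l β)
    (by ext; simp [seriesPow]) (fun n => by
      ext
      simp only [seriesPow, conv, Matrix.add_apply, Matrix.mul_apply, Matrix.of_apply]) α β
  simp only [Matrix.mul_apply, Matrix.of_apply, conv_csum] at this
  exact this

end Series

section Runs

open Matrix

variable {k v : ℕ} {S : Type*} [OmegaContinuousSemiring S]

theorem WNKA.run_isLinearMap (A : WNKA k v S) (π : Packet k v) (l : List (Packet k v))
    (β : Packet k v) : IsLinearMap S fun r : Fin A.n → S => A.run r π l β where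
  map_add r r' := by
    induction l generalizing r r' π with
    | nil => exact add_dotProduct _ _ _
    | cons c l ih => simp only [WNKA.run, add_vecMul, ih]
  map_smul s r := by
    induction l generalizing r π with
    | nil => exact smul_dotProduct _ _ _
    | cons c l ih => simp only [WNKA.run, smul_vecMul, ih]

theorem WNKA.conv_run_isLinearMap (A : WNKA k v S)
    (G : Packet k v → List (Packet k v) → Packet k v → S) (π : Packet k v)
    (l : List (Packet k v)) (β : Packet k v) :
    IsLinearMap S fun r : Fin A.n → S => conv G (A.run r π) l β where
  map_add r r' := by
    rw [← (conv_isLinearMap G l β).map_add]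
    congr 1
    funext l β
    exact (A.run_isLinearMap π l β).map_add r r'
  map_smul s r := by
    rw [← (conv_isLinearMap G l β).map_smul]
    congr 1
    funext l β
    exact (A.run_isLinearMap π l β).map_smul s r

theorem append_dotProduct_append {m n : ℕ} (a a' : Fin m → S) (b b' : Fin n → S) :
    Fin.append a b ⬝ᵥ Fin.append a' b' = a ⬝ᵥ a' + b ⬝ᵥ b' := by
  simp [dotProduct, Fin.sum_univ_add]

theorem append_vecMul_block {m n : ℕ} (r : Fin m → S) (r' : Fin n → S)
    (a : Matrix (Fin m) (Fin m) S) (b : Matrix (Fin m) (Fin n) S)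
    (c : Matrix (Fin n) (Fin m) S) (d : Matrix (Fin n) (Fin n) S) :
    Fin.append r r' ᵥ* block a b c d =
      Fin.append (r ᵥ* a + r' ᵥ* c) (r ᵥ* b + r' ᵥ* d) := by
  funext q
  simp only [vecMul, dotProduct, Fin.sum_univ_add, Fin.append_left, Fin.append_right, block]
  refine Fin.addCases (fun i => ?_) (fun i => ?_) q <;> simp [vecMul, dotProduct]

theorem vecMul_sum_vecMulVec {m n : ℕ} {K : Type*} (s : Finset K) (r : Fin m → S)
    (f : K → Fin m → S) (g : K → Fin n → S) :
    r ᵥ* (∑ γ ∈ s, vecMulVec (f γ) (g γ)) = ∑ γ ∈ s, (r ⬝ᵥ f γ) • g γ := by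
  funext q
  simp only [vecMul, dotProduct, Matrix.sum_apply, vecMulVec_apply, Finset.sum_apply, Pi.smul_apply,
    smul_eq_mul, Finset.sum_mul, Finset.mul_sum, mul_assoc]
  exact Finset.sum_comm

theorem dotProduct_sum_mul {m : ℕ} {K : Type*} [Fintype K] (r : Fin m → S)
    (f : K → Fin m → S) (c : K → S) :
    (r ⬝ᵥ fun q => ∑ γ, f γ q * c γ) = ∑ γ, (r ⬝ᵥ f γ) * c γ := by
  simp only [dotProduct, Finset.mul_sum, Finset.sum_mul, mul_assoc]
  exact Finset.sum_comm

theorem WNKA.run_zero (A : WNKA k v S) (π : Packet k v) (l : List (Packet k v)) (β : Packet k v) :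
    A.run 0 π l β = 0 :=
  (A.run_isLinearMap π l β).map_zero

theorem WNKA.run_choice (A B : WNKA k v S) (r : Fin A.n → S) (r' : Fin B.n → S) (α : Packet k v)
    (l : List (Packet k v)) (β : Packet k v) :
    (A.choice B).run (Fin.append r r' : Fin (A.n + B.n) → S) α l β =
      A.run r α l β + B.run r' α l β := by
  induction l generalizing r r' α with
  | nil => exact append_dotProduct_append _ _ _ _
  | cons c l ih =>
    have h : (Fin.append r r' : Fin (A.n + B.n) → S) ᵥ* (A.choice B).trans α c =
        Fin.append (r ᵥ* A.trans α c) (r' ᵥ* B.trans α c) := by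
      refine (append_vecMul_block _ _ _ _ _ _).trans ?_
      simp
    exact (congrArg (fun r => (A.choice B).run r c l β) h).trans (ih _ _ _)

theorem WNKA.run_seq (A B : WNKA k v S) (r : Fin A.n → S) (r' : Fin B.n → S) (α : Packet k v)
    (l : List (Packet k v)) (β : Packet k v) :
    (A.seq B).run (Fin.append r r' : Fin (A.n + B.n) → S) α l β =
      conv (B.run B.init) (A.run r α) l β + B.run r' α l β := by
  induction l generalizing r r' α with
  | nil =>
    have h : (A.seq B).run (Fin.append r r' : Fin (A.n + B.n) → S) α [] β =
        Fin.append r r' ⬝ᵥ Fin.append (fun q => ∑ γ, A.out α γ q * (B.init ⬝ᵥ B.out γ β))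
          (B.out α β) := rfl
    rw [h, append_dotProduct_append]
    simp only [conv, WNKA.run]
    exact congrArg₂ (· + ·) (dotProduct_sum_mul _ _ _) rfl
  | cons c l ih =>
    have h : (Fin.append r r' : Fin (A.n + B.n) → S) ᵥ* (A.seq B).trans α c =
        Fin.append (r ᵥ* A.trans α c)
          (∑ γ, (r ⬝ᵥ A.out α γ) • (B.init ᵥ* B.trans γ c) + r' ᵥ* B.trans α c) := by
      refine (append_vecMul_block _ _ _ _ _ _).trans ?_
      rw [vecMul_sum_vecMulVec]
      simp
    refine (congrArg (fun r => (A.seq B).run r c l β) h).trans ((ih _ _ _).trans ?_)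
    have hl := (B.run_isLinearMap c l β).map_add
      (∑ γ, (r ⬝ᵥ A.out α γ) • (B.init ᵥ* B.trans γ c)) (r' ᵥ* B.trans α c)
    have hs := map_sum (B.run_isLinearMap c l β).mk'
      (fun γ => (r ⬝ᵥ A.out α γ) • (B.init ᵥ* B.trans γ c)) Finset.univ
    simp only [map_smul, IsLinearMap.mk'_apply, smul_eq_mul] at hs
    rw [hl, hs, conv]
    simp only [WNKA.run]
    abel

theorem WNKA.run_star (A : WNKA k v S) (G : Packet k v → List (Packet k v) → Packet k v → S)
    (hnil : ∀ α β, G α [] β = A.heartOut α β)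
    (hcons : ∀ α c l β, G α (c :: l) β =
      ∑ γ, A.heartOut α γ * conv G (fun l => A.run A.init γ (c :: l)) l β)
    (r : Fin A.n → S) (s : S) (α : Packet k v) (l : List (Packet k v)) (β : Packet k v) :
    A.star.run (Fin.append r (fun _ => s) : Fin (A.n + 1) → S) α l β =
      conv G (A.run r α) l β + s * G α l β := by
  induction l generalizing r s α with
  | nil =>
    have h : A.star.run (Fin.append r (fun _ => s) : Fin (A.n + 1) → S) α [] β =
        (Fin.append r fun _ => s) ⬝ᵥ Fin.append (fun q => ∑ γ, A.out α γ q * A.heartOut γ β)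
          (fun _ => A.heartOut α β) := rfl
    rw [h, append_dotProduct_append]
    simp only [conv, WNKA.run, hnil]
    exact congrArg₂ (· + ·) (dotProduct_sum_mul _ _ _) (by simp [dotProduct])
  | cons c l ih =>
    have h : (Fin.append r (fun _ => s) : Fin (A.n + 1) → S) ᵥ* A.star.trans α c =
        Fin.append (r ᵥ* A.trans α c + ∑ γ, (r ⬝ᵥ A.out α γ) • A.heartTrans γ c +
          s • A.heartTrans α c) (fun _ => 0) := by
      refine (append_vecMul_block _ _ _ _ _ _).trans ?_
      rw [vecMul_add, vecMul_sum_vecMulVec]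
      congr 1
      · congr 1
        funext q
        simp [vecMul, dotProduct]
      · funext q
        simp
    have hlin := A.conv_run_isLinearMap G c l β
    have hheart : ∀ γ, conv G (A.run (A.heartTrans γ c) c) l β = G γ (c :: l) β := by
      intro γ
      rw [hcons]
      have : A.heartTrans γ c = ∑ γ', A.heartOut γ γ' • (A.init ᵥ* A.trans γ' c) := by
        funext q
        simp [WNKA.heartTrans]
      rw [this]
      have hs := map_sum hlin.mk' (fun γ' => A.heartOut γ γ' • (A.init ᵥ* A.trans γ' c))
        Finset.univ
      simp only [map_smul, IsLinearMap.mk'_apply, smul_eq_mul] at hs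
      exact hs
    refine (congrArg (fun r => A.star.run r c l β) h).trans ((ih _ _ _).trans ?_)
    rw [zero_mul, add_zero]
    have hs := map_sum hlin.mk' (fun γ => (r ⬝ᵥ A.out α γ) • A.heartTrans γ c) Finset.univ
    simp only [map_smul, IsLinearMap.mk'_apply, smul_eq_mul] at hs
    have h1 := hlin.map_add (r ᵥ* A.trans α c + ∑ γ, (r ⬝ᵥ A.out α γ) • A.heartTrans γ c)
      (s • A.heartTrans α c)
    have h2 := hlin.map_add (r ᵥ* A.trans α c) (∑ γ, (r ⬝ᵥ A.out α γ) • A.heartTrans γ c)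
    have h3 := hlin.map_smul s (A.heartTrans α c)
    rw [h1, h2, h3, hs, conv]
    simp only [hheart, WNKA.run, smul_eq_mul]
    abel

end Runs

section Correctness

open Matrix

variable {k v : ℕ} {S : Type*} [OmegaContinuousSemiring S]

/-- A denotation is local with series `F` if it only prepends packets to the history, with the
weights given by `F`, independently of the tail of the input history. -/
structure IsLocal (d : History k v → History k v → S)
    (F : Packet k v → List (Packet k v) → Packet k v → S) : Prop where
  apply : ∀ α β l t, d (α, t) (β, l.reverse ++ t) = F α l β
  eq_zero : ∀ h h' : History k v, ¬ h.2 <:+ h'.2 → d h h' = 0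

theorem bind_eta {X Y : Type*} [Encodable X] [DecidableEq X] (x : X) (f : X → Y → S) :
    bind (eta x) f = f x := by
  funext y
  refine (csum_eq_single x fun j hj => ?_).trans ?_
  · simp [eta, iverson, hj.symm]
  · simp [eta, iverson]

theorem IsLocal.eta : IsLocal (k := k) (v := v) (S := S) eta
    fun α l β => if l = [] ∧ α = β then 1 else 0 where
  apply α β l t := by
    simp only [WNetKAT.eta, iverson, Prod.mk.injEq, List.self_eq_append_left,
      List.reverse_eq_nil_iff, and_comm]
  eq_zero h h' hh := by
    simp only [WNetKAT.eta, iverson]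
    rw [if_neg]
    rintro rfl
    exact hh (List.suffix_refl _)

theorem IsLocal.bind {d e : History k v → History k v → S}
    {F G : Packet k v → List (Packet k v) → Packet k v → S} (hd : IsLocal d F) (he : IsLocal e G) :
    IsLocal (fun h => WNetKAT.bind (d h) e) fun α => conv G (F α) where
  apply α β l t := by
    let φ : Packet k v × ℕ → History k v := fun x => (x.1, (l.take x.2).reverse ++ t)
    let s : Finset (Packet k v × ℕ) := Finset.univ ×ˢ Finset.range (l.length + 1)
    have hφ : Set.InjOn φ s := by
      rintro ⟨γ, i⟩ hi ⟨γ', j⟩ hj h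
      simp only [s, Finset.coe_product, Finset.coe_range, Set.mem_prod, Set.mem_Iio] at hi hj
      simp only [φ, Prod.mk.injEq, List.append_cancel_right_eq, List.reverse_inj] at h
      have := congrArg List.length h.2
      simp only [List.length_take] at this
      refine Prod.ext h.1 ?_
      simp only
      omega
    refine (csum_eq_sum (s.image φ) fun h'' hh => ?_).trans ?_
    · by_cases h1 : t <:+ h''.2
      · by_cases h2 : h''.2 <:+ l.reverse ++ t
        · refine absurd ?_ hh
          obtain ⟨γ, u⟩ := h''
          obtain ⟨w, rfl⟩ := h1
          obtain ⟨w', hw⟩ := h2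
          rw [← List.append_assoc, List.append_cancel_right_eq] at hw
          have hl : l = w.reverse ++ w'.reverse := by
            rw [← List.reverse_append, hw, List.reverse_reverse]
          refine Finset.mem_image.2 ⟨(γ, w.length), ?_, ?_⟩
          · simp only [s, Finset.mem_product, Finset.mem_univ, Finset.mem_range, true_and, hl,
              List.length_append, List.length_reverse]
            omega
          · simp [φ, hl]
        · rw [he.eq_zero h'' (β, l.reverse ++ t) h2, mul_zero]
      · rw [hd.eq_zero (α, t) h'' h1, zero_mul]
    · rw [Finset.sum_image hφ, Finset.sum_product_right, conv_eq]
      refine Finset.sum_congr rfl fun i _ => Finset.sum_congr rfl fun γ _ => ?_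
      rw [show φ (γ, i) = (γ, (l.take i).reverse ++ t) from rfl, hd.apply, ← he.apply γ β _
        ((l.take i).reverse ++ t), ← List.append_assoc, ← List.reverse_append,
        List.take_append_drop]
  eq_zero h h' hh := by
    refine (congrArg csum (funext fun h'' => ?_)).trans csum_zero
    by_cases h1 : h.2 <:+ h''.2
    · rw [he.eq_zero h'' h' fun h2 => hh (h1.trans h2), mul_zero]
    · rw [hd.eq_zero h h'' h1, zero_mul]

theorem IsLocal.nfoldSem {d : History k v → History k v → S}
    {F : Packet k v → List (Packet k v) → Packet k v → S} (hd : IsLocal d F) (n : ℕ) :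
    IsLocal (nfoldSem d n) (seriesPow F n) := by
  induction n with
  | zero => exact IsLocal.eta
  | succ n ih => exact hd.bind ih

theorem IsLocal.star {d : History k v → History k v → S}
    {F : Packet k v → List (Packet k v) → Packet k v → S} (hd : IsLocal d F) :
    IsLocal (fun h h' => csum fun n => WNetKAT.nfoldSem d n h h') (seriesStar F) where
  apply α β l t := congrArg csum (funext fun n => (hd.nfoldSem n).apply α β l t)
  eq_zero h h' hh :=
    (congrArg csum (funext fun n => (hd.nfoldSem n).eq_zero h h' hh)).trans csum_zero

theorem sem_fold1_and (π π' : Packet k v) (L : List (Fin k)) :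
    (fold1 Pred.and Pred.tt (L.map fun f => Pred.test f (π f))).sem π' = true ↔
      ∀ f ∈ L, π' f = π f := by
  induction L with
  | nil => simp [fold1, Pred.sem]
  | cons f L ih =>
    cases L with
    | nil => simp [fold1, Pred.sem]
    | cons g L =>
      simp only [List.map_cons] at ih
      simp only [List.map_cons, fold1, Pred.sem, Bool.and_eq_true, ih, decide_eq_true_eq]
      simp

theorem sem_completeTest (π π' : Packet k v) : (completeTest π).sem π' = true ↔ π' = π := by
  rw [completeTest, sem_fold1_and]
  simp [funext_iff]

theorem sem_fold1_seq (π : Packet k v) (L : List (Fin k)) (h : History k v) :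
    (fold1 Policy.seq (Policy.filter Pred.tt) (L.map fun f => Policy.assign f (π f)) :
        Policy k v S).sem h =
      eta (L.foldl (fun α f => Function.update α f (π f)) h.1, h.2) := by
  induction L generalizing h with
  | nil =>
    funext h'
    simp [fold1, Policy.sem, Pred.sem, iverson]
  | cons f L ih =>
    cases L with
    | nil => simp [fold1, Policy.sem]
    | cons g L =>
      simp only [List.map_cons] at ih
      simp only [List.map_cons, fold1, Policy.sem, bind_eta, ih, List.foldl_cons]

theorem foldl_update_apply (π α : Packet k v) (L : List (Fin k)) (g : Fin k) :
    L.foldl (fun α f => Function.update α f (π f)) α g = if g ∈ L then π g else α g := by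
  induction L generalizing α with
  | nil => simp
  | cons f L ih =>
    rw [List.foldl_cons, ih]
    by_cases h : g ∈ L
    · simp [h]
    · by_cases hg : g = f
      · subst hg; simp [h]
      · simp [h, hg]

theorem sem_completeAssign (π : Packet k v) (h : History k v) :
    (completeAssign π : Policy k v S).sem h = eta (π, h.2) := by
  rw [completeAssign, sem_fold1_seq]
  congr 2
  funext f
  simp [foldl_update_apply]

theorem sem_ctest (π : Packet k v) (h h' : History k v) :
    (RPolicy.ctest π : RPolicy k v S).toPolicy.sem h h' = iverson S (h.1 = π) * eta h h' := by
  simp only [RPolicy.toPolicy, Policy.sem, iverson, sem_completeTest]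

theorem sem_rpolicy_sum (L : List (RPolicy k v S)) (h h' : History k v) :
    (RPolicy.sum L).toPolicy.sem h h' = (L.map fun p => p.toPolicy.sem h h').sum := by
  unfold RPolicy.sum
  induction L with
  | nil => simp [fold1, RPolicy.toPolicy, Policy.sem]
  | cons p L ih =>
    cases L with
    | nil => simp [fold1]
    | cons q L =>
      simp only [fold1, RPolicy.toPolicy, Policy.sem]
      rw [ih, List.map_cons, List.map_cons, List.sum_cons]
      rfl

theorem sum_map_packets (g : Packet k v → S) : ((packets k v).map g).sum = ∑ π, g π := by
  rw [packets, List.map_ofFn, List.sum_ofFn]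
  exact Equiv.sum_comp finFunctionFinEquiv.symm g

/-- Reduction preserves the semantics. -/
theorem Policy.sem_reduce (p : Policy k v S) : p.reduce.toPolicy.sem = p.sem := by
  induction p with
  | filter t =>
    funext h h'
    rw [Policy.reduce, sem_rpolicy_sum, List.map_map, sum_map_packets,
      Finset.sum_eq_single h.1 (fun π _ hπ => ?_) (by simp)]
    · simp only [Function.comp_apply, RPolicy.toPolicy, Policy.sem]
      simp [iverson, (sem_completeTest _ _).2]
    · have := sem_ctest (S := S) π h h'
      simp only [RPolicy.toPolicy] at this
      rw [iverson, if_neg hπ.symm, zero_mul] at this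
      exact (congrArg (iverson S (t.sem π = true) * ·) this).trans (mul_zero _)
  | assign f n =>
    have key : ∀ (π : Packet k v) (h h' : History k v),
        ((RPolicy.ctest π).seq (RPolicy.cassign (Function.update π f n)) :
          RPolicy k v S).toPolicy.sem h h' =
        iverson S (h.1 = π) * eta (Function.update π f n, h.2) h' := by
      intro π h h'
      have hb := congrFun (bind_eta (S := S) h
        (completeAssign (Function.update π f n) : Policy k v S).sem) h'
      rw [sem_completeAssign] at hb
      rw [← hb]
      simp only [RPolicy.toPolicy, Policy.sem, bind, mul_csum]
      refine congrArg csum (funext fun h'' => ?_)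
      rw [← mul_assoc]
      congr 1
      exact sem_ctest π h h''
    funext h h'
    rw [Policy.reduce, sem_rpolicy_sum, List.map_map, sum_map_packets,
      Finset.sum_eq_single h.1 (fun π _ hπ => ?_) (by simp)]
    · rw [Function.comp_apply, key]
      simp [iverson, Policy.sem]
    · rw [Function.comp_apply, key]
      simp [iverson, hπ.symm]
  | dup => rfl
  | seq p q ihp ihq => simp only [Policy.reduce, RPolicy.toPolicy, Policy.sem, ihp, ihq]
  | weigh s p ih => simp only [Policy.reduce, RPolicy.toPolicy, Policy.sem, ih]
  | choice p q ihp ihq => simp only [Policy.reduce, RPolicy.toPolicy, Policy.sem, ihp, ihq]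
  | star p ih => simp only [Policy.reduce, RPolicy.toPolicy, Policy.sem, ih]

theorem isLocal_ctest (π : Packet k v) :
    IsLocal (RPolicy.ctest π : RPolicy k v S).toPolicy.sem
      fun α l β => (WNKA.ctest π).sem (α, l, β) where
  apply α β l t := by
    rw [sem_ctest, IsLocal.eta.apply]
    cases l with
    | nil =>
      change _ = ∑ _i : Fin 1, 1 * iverson S (α = β ∧ β = π)
      simp only [iverson]
      by_cases h : α = β
      · subst h; simp
      · simp [h]
    | cons c l =>
      have h : ((WNKA.ctest π : WNKA k v S).init ᵥ* (WNKA.ctest π : WNKA k v S).trans α c) = 0 :=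
        vecMul_zero _
      simp only [WNKA.sem, WNKA.run]
      rw [h, WNKA.run_zero]
      simp
  eq_zero h h' hh := by rw [sem_ctest, IsLocal.eta.eq_zero h h' hh, mul_zero]

theorem isLocal_cassign (π : Packet k v) :
    IsLocal (RPolicy.cassign π : RPolicy k v S).toPolicy.sem
      fun α l β => (WNKA.cassign π).sem (α, l, β) where
  apply α β l t := by
    rw [RPolicy.toPolicy, sem_completeAssign, IsLocal.eta.apply]
    cases l with
    | nil =>
      change _ = ∑ _i : Fin 1, 1 * iverson S (β = π)
      simp [iverson, eq_comm]
    | cons c l =>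
      have h : ((WNKA.cassign π : WNKA k v S).init ᵥ* (WNKA.cassign π : WNKA k v S).trans α c) =
        0 := vecMul_zero _
      simp only [WNKA.sem, WNKA.run]
      rw [h, WNKA.run_zero]
      simp
  eq_zero h h' hh := by
    rw [RPolicy.toPolicy, sem_completeAssign]
    exact IsLocal.eta.eq_zero (π, h.2) h' hh

theorem run_dup_nil (u : Fin 2 → S) (α β : Packet k v) :
    (WNKA.dup : WNKA k v S).run u α [] β = u 1 * iverson S (α = β) := by
  change ∑ i : Fin 2, u i * iverson S (i = 1 ∧ α = β) = _
  simp [iverson]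

theorem run_dup_cons (u : Fin 2 → S) (α c β : Packet k v) (l : List (Packet k v)) :
    (WNKA.dup : WNKA k v S).run u α (c :: l) β = (WNKA.dup : WNKA k v S).run
      (fun q : Fin 2 => u 0 * iverson S (q = 1 ∧ α = c)) c l β := by
  have h : u ᵥ* (WNKA.dup : WNKA k v S).trans α c =
      fun q : Fin 2 => u 0 * iverson S (q = 1 ∧ α = c) := by
    funext (q : Fin 2)
    change ∑ i : Fin 2, u i * iverson S (i = 0 ∧ q = 1 ∧ α = c) = _
    simp [iverson]
  exact congrArg (fun r => (WNKA.dup : WNKA k v S).run r c l β) h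

theorem isLocal_dup :
    IsLocal (RPolicy.dup : RPolicy k v S).toPolicy.sem
      fun α l β => WNKA.dup.sem (α, l, β) where
  apply α β l t := by
    simp only [RPolicy.toPolicy, Policy.sem]
    change _ = (WNKA.dup : WNKA k v S).run (fun q : Fin 2 => iverson S (q = 0)) α l β
    match l with
    | [] => simp [run_dup_nil, iverson, eta]
    | [c] =>
      rw [run_dup_cons, run_dup_nil]
      simp only [iverson, eta]
      by_cases h : α = c
      · subst h; simp
      · simp [h]
    | c :: c' :: l =>
      rw [run_dup_cons, run_dup_cons]
      have h0 : (fun q : Fin 2 => (iverson S ((0 : Fin 2) = 0) *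
          iverson S ((0 : Fin 2) = 1 ∧ α = c)) * iverson S (q = 1 ∧ c = c')) = 0 := by
        funext q
        simp [iverson]
      refine Eq.trans ?_ ((congrArg (fun r => (WNKA.dup : WNKA k v S).run r c' l β) h0).trans
        (WNKA.run_zero _ _ _ _)).symm
      simp only [eta, iverson]
      rw [if_neg]
      intro h
      have := congrArg List.length (Prod.mk.inj h).2
      simp at this
      omega
  eq_zero h h' hh := by
    simp only [RPolicy.toPolicy, Policy.sem, eta, iverson]
    rw [if_neg]
    rintro rfl
    exact hh (List.suffix_cons _ _)

/-- The automaton of a reduced policy computes its semantics. -/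
theorem RPolicy.isLocal (p : RPolicy k v S) :
    IsLocal p.toPolicy.sem fun α l β => p.thompson.sem (α, l, β) := by
  induction p with
  | ctest π => exact isLocal_ctest π
  | cassign π => exact isLocal_cassign π
  | dup => exact isLocal_dup
  | seq p q ihp ihq =>
    have h : (fun α l β => (p.seq q).thompson.sem (α, l, β)) =
        fun α => conv (fun α l β => q.thompson.sem (α, l, β))
          (fun l β => p.thompson.sem (α, l, β)) := by
      funext α l β
      refine (WNKA.run_seq p.thompson q.thompson p.thompson.init 0 α l β).trans ?_
      rw [WNKA.run_zero, add_zero]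
      rfl
    rw [h]
    exact ihp.bind ihq
  | weigh s p ih =>
    have h : ∀ α l β, (p.weigh s).thompson.sem (α, l, β) = s * p.thompson.sem (α, l, β) := by
      intro α l β
      rw [WNKA.sem, WNKA.sem]
      have := (p.thompson.run_isLinearMap α l β).map_smul s p.thompson.init
      refine Eq.trans ?_ this
      simp only [RPolicy.thompson]
      generalize p.thompson = A
      have key : ∀ l (r : Fin A.n → S) α, (WNKA.weigh s A).run r α l β = A.run r α l β := by
        intro l
        induction l with
        | nil => intro r α; rfl
        | cons c l ih => intro r α; exact ih _ _
      exact key _ _ _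
    exact ⟨fun α β l t => by rw [h, ← ih.apply α β l t]; rfl, fun h h' hh =>
      (congrArg (s * ·) (ih.eq_zero h h' hh)).trans (mul_zero s)⟩
  | choice p q ihp ihq =>
    refine ⟨fun α β l t => ?_, fun h h' hh => ?_⟩
    · refine Eq.trans ?_
        (WNKA.run_choice p.thompson q.thompson p.thompson.init q.thompson.init α l β).symm
      exact congrArg₂ (· + ·) (ihp.apply α β l t) (ihq.apply α β l t)
    · refine (congrArg₂ (· + ·) (ihp.eq_zero h h' hh) (ihq.eq_zero h h' hh)).trans (add_zero 0)
  | star p ih =>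
    have h : (fun α l β => p.star.thompson.sem (α, l, β)) =
        seriesStar fun α l β => p.thompson.sem (α, l, β) := by
      funext α l β
      refine (WNKA.run_star p.thompson (seriesStar fun α l β => p.thompson.sem (α, l, β))
        (fun α β => seriesStar_nil _ α β) (fun α c l β => seriesStar_cons _ α c β l)
        0 1 α l β).trans ?_
      have := (p.thompson.conv_run_isLinearMap
        (seriesStar fun α l β => p.thompson.sem (α, l, β)) α l β).map_zero
      rw [this, zero_add, one_mul]
    rw [h]
    exact ih.star

theorem Policy.sem_eq_zero (p : Policy k v S) {h h' : History k v} (hh : ¬ h.2 <:+ h'.2) :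
    p.sem h h' = 0 := by
  rw [← p.sem_reduce]
  exact p.reduce.isLocal.eq_zero h h' hh

/-- The semantics of policies in terms of automata. -/
theorem Policy.sem_eq_thompson (p : Policy k v S) (h h' : History k v) :
    p.sem h h' = if h.2 = h'.2.drop (h'.2.length - h.2.length) then
      p.reduce.thompson.sem (h.1, (h'.2.take (h'.2.length - h.2.length)).reverse, h'.1) else 0 := by
  split_ifs with hh
  · have e := (congrArg (h'.2.take (h'.2.length - h.2.length) ++ ·) hh).trans
      (List.take_append_drop _ _)
    rw [← p.reduce.isLocal.apply h.1 h'.1 _ h.2, List.reverse_reverse, p.sem_reduce, e]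
  · exact p.sem_eq_zero fun hs => hh (List.suffix_iff_eq_drop.1 hs)

end Correctness

theorem encode_list_map {α : Type*} [Encodable α] (l : List α) :
    encode (l.map encode : List ℕ) = encode l := by
  induction l with
  | nil => rfl
  | cons a l ih => rw [List.map_cons, encode_list_cons, encode_list_cons, ih, encode_nat]

theorem encode_option_map {α : Type*} [Encodable α] (o : Option α) :
    encode (o.map encode : Option ℕ) = encode o := by
  cases o <;> rfl

namespace IsComputable

section Basic

variable {α β γ σ : Type*} [Encodable α] [Encodable β] [Encodable γ] [Encodable σ]

theorem of_eq {f g : α → β} (hf : IsComputable f) (h : ∀ a, f a = g a) : IsComputable g :=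
  (funext h : f = g) ▸ hf

theorem of_encode_eq {f : α → β} {g : α → γ} (hf : IsComputable f)
    (h : ∀ a, encode (f a) = encode (g a)) : IsComputable g := by
  obtain ⟨F, hF, hF'⟩ := hf
  exact ⟨F, hF, fun a => (hF' a).trans (h a)⟩

theorem of_computable {α β : Type*} [Primcodable α] [Primcodable β] {f : α → β}
    (hf : Computable f) : IsComputable f :=
  ⟨fun n => ((decode n : Option α).map fun a => encode (f a)).getD 0,
    Computable.option_getD (Computable.option_map Computable.decode
      ((Computable.encode.comp hf).comp Computable.snd).to₂) (Computable.const 0),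
    fun a => by simp⟩

protected theorem id : IsComputable fun a : α => a := ⟨fun n => n, Computable.id, fun _ => rfl⟩

theorem const (b : β) : IsComputable fun _ : α => b :=
  ⟨fun _ => encode b, Computable.const _, fun _ => rfl⟩

theorem encode : IsComputable fun a : α => Encodable.encode a :=
  ⟨fun n => n, Computable.id, fun _ => rfl⟩

theorem comp {g : β → γ} {f : α → β} (hg : IsComputable g) (hf : IsComputable f) :
    IsComputable fun a => g (f a) := by
  obtain ⟨F, hF, hF'⟩ := hf
  obtain ⟨G, hG, hG'⟩ := hg
  exact ⟨fun n => G (F n), hG.comp hF, fun a => by simp only [hF', hG']⟩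

theorem pair {f : α → β} {g : α → γ} (hf : IsComputable f) (hg : IsComputable g) :
    IsComputable fun a => (f a, g a) := by
  obtain ⟨F, hF, hF'⟩ := hf
  obtain ⟨G, hG, hG'⟩ := hg
  exact ⟨fun n => Nat.pair (F n) (G n), Primrec₂.natPair.to_comp.comp hF hG, fun a => by
    simp only [hF', hG', encode_prod_val]⟩

theorem fst : IsComputable fun x : α × β => x.1 :=
  ⟨fun n => n.unpair.1, Computable.fst.comp Computable.unpair, fun ⟨a, b⟩ => by
    simp only [encode_prod_val, Nat.unpair_pair]⟩

theorem snd : IsComputable fun x : α × β => x.2 :=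
  ⟨fun n => n.unpair.2, Computable.snd.comp Computable.unpair, fun ⟨a, b⟩ => by
    simp only [encode_prod_val, Nat.unpair_pair]⟩

theorem nat_rec {n : α → ℕ} {f : α → β} {h : α → ℕ → β → β} (hn : IsComputable n)
    (hf : IsComputable f) (hh : IsComputable fun x : α × ℕ × β => h x.1 x.2.1 x.2.2) :
    IsComputable fun a => (Nat.rec (f a) (h a) (n a) : β) := by
  obtain ⟨N, hN, hN'⟩ := hn
  obtain ⟨F, hF, hF'⟩ := hf
  obtain ⟨H, hH, hH'⟩ := hh
  refine ⟨fun c => Nat.rec (F c) (fun m b => H (Nat.pair c (Nat.pair m b))) (N c),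
    Computable.nat_rec (h := fun c (x : ℕ × ℕ) => H (Nat.pair c (Nat.pair x.1 x.2))) hN hF
      (hH.comp (Primrec₂.natPair.to_comp.comp Computable.fst
        (Primrec₂.natPair.to_comp.comp (Computable.fst.comp Computable.snd)
          (Computable.snd.comp Computable.snd)))).to₂, fun a => ?_⟩
  simp only [hN', encode_nat]
  induction n a with
  | zero => exact hF' a
  | succ m ih => simp only [ih, ← hH' (a, m, _), encode_prod_val, encode_nat]

theorem decide_eq [DecidableEq β] {f g : α → β} (hf : IsComputable f) (hg : IsComputable g) :
    IsComputable fun a => decide (f a = g a) := by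
  refine ((of_computable (Primrec.eq (α := ℕ)).decide.to_comp).comp
    ((encode.comp hf).pair (encode.comp hg))).of_eq fun a => ?_
  simp

theorem ite {p : α → Prop} [DecidablePred p] {f g : α → β}
    (hp : IsComputable fun a => decide (p a)) (hf : IsComputable f) (hg : IsComputable g) :
    IsComputable fun a => if p a then f a else g a := by
  obtain ⟨P, hP, hP'⟩ := hp
  obtain ⟨F, hF, hF'⟩ := hf
  obtain ⟨G, hG, hG'⟩ := hg
  refine ⟨fun n => bif decide (P n = 1) then F n else G n,
    Computable.cond ((Primrec.eq (α := ℕ)).decide.to_comp.comp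
      hP (Computable.const 1)) hF hG, fun a => ?_⟩
  simp only [hP', hF', hG']
  by_cases h : p a <;> simp [h]

theorem lt {f g : α → ℕ} (hf : IsComputable f) (hg : IsComputable g) :
    IsComputable fun a => decide (f a < g a) :=
  (of_computable Primrec.nat_lt.decide.to_comp).comp (hf.pair hg)

theorem nat_sub {f g : α → ℕ} (hf : IsComputable f) (hg : IsComputable g) :
    IsComputable fun a => f a - g a :=
  (of_computable Primrec.nat_sub.to_comp).comp (hf.pair hg)

theorem nat_add {f g : α → ℕ} (hf : IsComputable f) (hg : IsComputable g) :
    IsComputable fun a => f a + g a :=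
  (of_computable Primrec.nat_add.to_comp).comp (hf.pair hg)

/-- Case distinction on a finite type. -/
theorem finite_cases [Finite γ] {i : α → γ} {f : γ → α → β} (hi : IsComputable i)
    (hf : ∀ c, IsComputable (f c)) : IsComputable fun a => f (i a) a := by
  choose F hF hF' using hf
  obtain ⟨I, hI, hI'⟩ := hi
  have key : ∀ L : List γ, ∃ G : ℕ → ℕ, Computable G ∧
      ∀ a, i a ∈ L → G (Encodable.encode a) = F (i a) (Encodable.encode a) := by
    intro L
    induction L with
    | nil => exact ⟨fun _ => 0, Computable.const 0, by simp⟩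
    | cons c L ih =>
      obtain ⟨G, hG, hG'⟩ := ih
      refine ⟨fun n => bif decide (I n = Encodable.encode c) then F c n else G n,
        Computable.cond ((Primrec.eq (α := ℕ)).decide.to_comp.comp
          hI (Computable.const _)) (hF c) hG, fun a ha => ?_⟩
      by_cases h : i a = c
      · simp [hI', h]
      · simp [hI', h, hG' a ((List.mem_cons.1 ha).resolve_left h)]
  obtain ⟨_⟩ := nonempty_fintype γ
  obtain ⟨G, hG, hG'⟩ := key Finset.univ.toList
  exact ⟨G, hG, fun a => by rw [hG' a (by simp), hF']⟩

theorem of_finite [Finite α] (f : α → β) : IsComputable f :=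
  finite_cases (f := fun c _ => f c) IsComputable.id fun c => const (f c)

theorem option_elim {o : α → Option β} {f : α → σ} {g : α → β → σ} (ho : IsComputable o)
    (hf : IsComputable f) (hg : IsComputable fun x : α × β => g x.1 x.2) :
    IsComputable fun a => (o a).elim (f a) (g a) := by
  obtain ⟨O, hO, hO'⟩ := ho
  obtain ⟨F, hF, hF'⟩ := hf
  obtain ⟨G, hG, hG'⟩ := hg
  refine ⟨fun c => Nat.casesOn (O c) (F c) fun b => G (Nat.pair c b),
    Computable.nat_casesOn (h := fun c b => G (Nat.pair c b)) hO hF (hG.comp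
      (Primrec₂.natPair.to_comp.comp Computable.fst Computable.snd)).to₂, fun a => ?_⟩
  simp only [hO']
  cases o a with
  | none => exact hF' a
  | some b => simp only [encode_some, Option.elim_some, ← hG' (a, b), encode_prod_val]

end Basic

section Lists

variable {α β γ σ : Type*} [Encodable α] [Encodable β] [Encodable γ] [Encodable σ]

theorem list_cons {f : α → β} {l : α → List β} (hf : IsComputable f) (hl : IsComputable l) :
    IsComputable fun a => f a :: l a := by
  obtain ⟨F, hF, hF'⟩ := hf
  obtain ⟨L, hL, hL'⟩ := hl
  exact ⟨fun n => (Nat.pair (F n) (L n)).succ,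
    Computable.succ.comp (Primrec₂.natPair.to_comp.comp hF hL),
    fun a => by simp only [hF', hL', encode_list_cons]⟩

theorem list_map_encode : IsComputable fun l : List β => (l.map Encodable.encode : List ℕ) :=
  ⟨fun n => n, Computable.id, fun l => (encode_list_map l).symm⟩

theorem list_length : IsComputable fun l : List β => l.length :=
  ((of_computable Computable.list_length).comp list_map_encode).of_eq fun l => by simp

theorem list_reverse : IsComputable fun l : List β => l.reverse :=
  ((of_computable Computable.list_reverse).comp list_map_encode).of_encode_eq fun l => by
    rw [← List.map_reverse, encode_list_map]

theorem list_concat {f : α → β} {l : α → List β} (hl : IsComputable l) (hf : IsComputable f) :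
    IsComputable fun a => l a ++ [f a] :=
  (list_reverse.comp (list_cons hf (list_reverse.comp hl))).of_eq fun a => by simp

theorem list_getElem? {l : α → List β} {n : α → ℕ} (hl : IsComputable l) (hn : IsComputable n) :
    IsComputable fun a => (l a)[n a]? :=
  ((of_computable Computable.list_getElem?).comp
    ((list_map_encode.comp hl).pair hn)).of_encode_eq fun a => by
      simp only [List.getElem?_map, encode_option_map]

theorem list_getD {l : α → List β} {n : α → ℕ} (hl : IsComputable l) (hn : IsComputable n)
    (d : β) : IsComputable fun a => (l a).getD (n a) d :=
  (option_elim (list_getElem? hl hn) (const d) snd).of_eq fun a => by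
    rw [List.getD_eq_getElem?_getD]
    cases (l a)[n a]? <;> rfl

theorem list_drop {l : α → List β} {n : α → ℕ} (hl : IsComputable l) (hn : IsComputable n) :
    IsComputable fun a => (l a).drop (n a) :=
  ((of_computable Primrec.list_drop.to_comp).comp
    (hn.pair (list_map_encode.comp hl))).of_encode_eq fun a => by
      rw [← List.map_drop, encode_list_map]

theorem list_take {l : α → List β} {n : α → ℕ} (hl : IsComputable l) (hn : IsComputable n) :
    IsComputable fun a => (l a).take (n a) :=
  ((of_computable Primrec.list_take.to_comp).comp
    (hn.pair (list_map_encode.comp hl))).of_encode_eq fun a => by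
      rw [← List.map_take, encode_list_map]

theorem list_tabulate {n : α → ℕ} {f : α → ℕ → β} (hn : IsComputable n)
    (hf : IsComputable fun x : α × ℕ => f x.1 x.2) :
    IsComputable fun a => (List.range (n a)).map (f a) := by
  refine (nat_rec (h := fun a m l => l ++ [f a m]) hn (const ([] : List β))
    (list_concat (snd.comp snd) (hf.comp (fst.pair (fst.comp snd))))).of_eq fun a => ?_
  induction n a with
  | zero => rfl
  | succ m ih => rw [List.range_succ, List.map_append, ← ih]; rfl

theorem list_ofFn {n : ℕ} {f : Fin n → α → β} (hf : ∀ i, IsComputable (f i)) :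
    IsComputable fun a => List.ofFn fun i => f i a := by
  induction n with
  | zero => simpa using const []
  | succ n ih =>
    simp only [List.ofFn_succ]
    exact list_cons (hf 0) (ih fun i => hf i.succ)

theorem foldl_take_eq_rec {β σ : Type*} (h : σ → β → σ) (s : σ) (l : List β)
    (n : ℕ) :
    (Nat.rec s (fun m s => (l[m]?).elim s (h s)) n : σ) = (l.take n).foldl h s := by
  induction n with
  | zero => rfl
  | succ n ih =>
    rw [List.take_add_one, List.foldl_append, ← ih]
    change (l[n]?).elim _ (h _) = _
    cases l[n]? <;> rfl

theorem list_foldl {l : α → List β} {s : α → σ} {h : α → σ → β → σ} (hl : IsComputable l)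
    (hs : IsComputable s) (hh : IsComputable fun x : α × σ × β => h x.1 x.2.1 x.2.2) :
    IsComputable fun a => (l a).foldl (h a) (s a) := by
  refine (nat_rec (h := fun a m s => ((l a)[m]?).elim s (h a s)) (list_length.comp hl) hs
    (option_elim (list_getElem? (hl.comp fst) (fst.comp snd)) (snd.comp snd)
      (hh.comp ((fst.comp fst).pair ((snd.comp (snd.comp fst)).pair snd))))).of_eq fun a => ?_
  rw [foldl_take_eq_rec, List.take_length]

end Lists

section Recursion

theorem _root_.Computable.ite_tag {σ : Type*} [Primcodable σ] {f g : ℕ × σ → ℕ}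
    (hf : Computable f) (hg : Computable g) (t : ℕ) :
    Computable fun x : ℕ × σ => if x.1 = t then f x else g x :=
  (Computable.cond ((Primrec.eq (α := ℕ)).decide.to_comp.comp
    Computable.fst (Computable.const t)) hf hg).of_eq fun x => by
      by_cases h : x.1 = t <;> simp [h]

/-- Structural recursion on codes: the value at a code `⟨tag, arg⟩` may depend on the values at
`arg` and at the components of `arg`. -/
theorem of_code_rec {T β : Type*} [Encodable T] [Encodable β] {f : T → β}
    (φ : ℕ × ℕ × ℕ × ℕ × ℕ → ℕ) (hφ : Computable φ)
    (h : ∀ (t : T) (L : ℕ → ℕ),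
      (∀ u : T, Encodable.encode u < Encodable.encode t →
        L (Encodable.encode u) = Encodable.encode (f u)) →
      φ ((Encodable.encode t).unpair.1, (Encodable.encode t).unpair.2,
        L (Encodable.encode t).unpair.2, L (Encodable.encode t).unpair.2.unpair.1,
        L (Encodable.encode t).unpair.2.unpair.2) = Encodable.encode (f t)) :
    IsComputable f := by
  let step : ℕ × List ℕ → ℕ := fun x => φ (x.1.unpair.1, x.1.unpair.2, x.2.getD x.1.unpair.2 0,
    x.2.getD x.1.unpair.2.unpair.1 0, x.2.getD x.1.unpair.2.unpair.2 0)
  have hget : ∀ {g : ℕ × List ℕ → ℕ}, Computable g →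
      Computable fun x : ℕ × List ℕ => x.2.getD (g x) 0 := fun hg =>
    (Primrec.list_getD 0).to_comp.comp Computable.snd hg
  have harg : Computable fun x : ℕ × List ℕ => x.1.unpair.2 :=
    Computable.snd.comp (Computable.unpair.comp Computable.fst)
  have hstep : Computable step :=
    hφ.comp ((Computable.fst.comp (Computable.unpair.comp Computable.fst)).pair
      (harg.pair ((hget harg).pair ((hget (Computable.fst.comp (Computable.unpair.comp harg))).pair
        (hget (Computable.snd.comp (Computable.unpair.comp harg)))))))
  let G : ℕ → List ℕ := fun n => Nat.rec [] (fun m l => l ++ [step (m, l)]) n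
  have hG : Computable G :=
    Computable.nat_rec (h := fun (_ : ℕ) (x : ℕ × List ℕ) => x.2 ++ [step x]) Computable.id
      (Computable.const []) (Computable.list_concat.comp (Computable.snd.comp Computable.snd)
        (hstep.comp Computable.snd)).to₂
  have hlen : ∀ n, (G n).length = n := by
    intro n
    induction n with
    | zero => rfl
    | succ n ih =>
      rw [show G (n + 1) = G n ++ [step (n, G n)] from rfl, List.length_append, ih]; rfl
  have key : ∀ n (u : T), Encodable.encode u < n →
      (G n).getD (Encodable.encode u) 0 = Encodable.encode (f u) := by
    intro n
    induction n with
    | zero => intro u hu; exact absurd hu (Nat.not_lt_zero _)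
    | succ n ih =>
      intro u hu
      rw [show G (n + 1) = G n ++ [step (n, G n)] from rfl]
      rcases Nat.lt_succ_iff_lt_or_eq.1 hu with hu | hu
      · rw [List.getD_append _ _ _ _ (by rwa [hlen]), ih u hu]
      · rw [List.getD_append_right _ _ _ _ (by rw [hlen, hu]), hlen, hu, Nat.sub_self]
        subst hu
        exact h u (fun m => (G (Encodable.encode u)).getD m 0) ih
  exact ⟨fun n => step (n, G n), hstep.comp (Computable.id.pair hG), fun u =>
    h u (fun m => (G (Encodable.encode u)).getD m 0) (key _)⟩

end Recursion

end IsComputable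

namespace IsComputableSemiring

variable {S : Type*} [OmegaContinuousSemiring S] [Encodable S]
  {α : Type*} [Encodable α]

theorem add' (hS : IsComputableSemiring S) {f g : α → S} (hf : IsComputable f)
    (hg : IsComputable g) :
    IsComputable fun a => f a + g a :=
  hS.add.comp (hf.pair hg)

theorem mul' (hS : IsComputableSemiring S) {f g : α → S} (hf : IsComputable f)
    (hg : IsComputable g) :
    IsComputable fun a => f a * g a :=
  hS.mul.comp (hf.pair hg)

theorem sum (hS : IsComputableSemiring S) {K : Type*} (s : Finset K) {f : K → α → S}
    (hf : ∀ i, IsComputable (f i)) :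
    IsComputable fun a => ∑ i ∈ s, f i a := by
  classical
  induction s using Finset.induction_on with
  | empty => simpa using IsComputable.const 0
  | insert i s hi ih =>
    simp only [Finset.sum_insert hi]
    exact hS.add' (hf i) ih

theorem sum_range (hS : IsComputableSemiring S) {n : α → ℕ} {f : α → ℕ → S} (hn : IsComputable n)
    (hf : IsComputable fun x : α × ℕ => f x.1 x.2) :
    IsComputable fun a => ∑ i ∈ Finset.range (n a), f a i := by
  refine (IsComputable.nat_rec (h := fun a m s => s + f a m) hn (IsComputable.const 0)
    (hS.add' (.comp .snd .snd) (hf.comp (.pair .fst (.comp .fst .snd))))).of_eq fun a => ?_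
  induction n a with
  | zero => rfl
  | succ m ih => rw [Finset.sum_range_succ, ← ih]

theorem matStar (hS : IsComputableSemiring S) {X : Type*} [Fintype X] [DecidableEq X]
    {M : α → Matrix X X S}
    (hM : ∀ i j, IsComputable fun a => M a i j) (i j : X) :
    IsComputable fun a => WNetKAT.matStar (M a) i j := by
  let R : Finset X → α → Matrix X X S :=
    fun s a => Matrix.of fun i j => if i ∈ s then M a i j else 0
  have key : ∀ s i j, IsComputable fun a => WNetKAT.matStar (R s a) i j := by
    intro s
    induction s using Finset.induction_on with
    | empty =>
      intro i j
      refine (IsComputable.const ((1 : Matrix X X S) i j)).of_eq fun a => ?_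
      have : R ∅ a = 0 := by ext; simp [R]
      rw [this, matStar_zero]
    | insert k s hk ih =>
      intro i j
      have hR : ∀ a, R (insert k s) a =
          R s a + Matrix.of fun i j => if i = k then M a k j else 0 := by
        intro a
        ext i j
        by_cases h : i = k
        · subst h; simp [R, hk]
        · simp [R, h]
      have hsum : ∀ j, IsComputable fun a => ∑ b, M a k b * WNetKAT.matStar (R s a) b j :=
        fun j => hS.sum _ fun b => hS.mul' (hM k b) (ih b j)
      refine (hS.add' (ih i j) (hS.mul' (ih i k)
        (hS.mul' (hS.star.comp (hsum k)) (hsum j)))).of_eq fun a => ?_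
      rw [hR, matStar_add_row]
  refine (key Finset.univ i j).of_eq fun a => ?_
  rw [show R Finset.univ a = M a by ext; simp [R]]

end IsComputableSemiring

section Blocks

/-- Concatenation of vectors indexed by natural numbers. -/
def appendD {S : Type*} (n : ℕ) (f g : ℕ → S) (i : ℕ) : S := if i < n then f i else g (i - n)

theorem appendD_val {S : Type*} {m n : ℕ} {f : Fin m → S} {g : Fin n → S} {f' g' : ℕ → S}
    (hf : ∀ i : Fin m, f' i = f i) (hg : ∀ i : Fin n, g' i = g i) (q : Fin (m + n)) :
    appendD m f' g' q = Fin.append f g q := by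
  refine Fin.addCases (fun i => ?_) (fun i => ?_) q <;> simp [appendD, hf, hg]

theorem blockD_val {S : Type*} {m n : ℕ} {a : Matrix (Fin m) (Fin m) S}
    {b : Matrix (Fin m) (Fin n) S} {c : Matrix (Fin n) (Fin m) S} {d : Matrix (Fin n) (Fin n) S}
    {a' b' c' d' : ℕ → ℕ → S}
    (ha : ∀ (i : Fin m) (j : Fin m), a' i j = a i j)
    (hb : ∀ (i : Fin m) (j : Fin n), b' i j = b i j)
    (hc : ∀ (i : Fin n) (j : Fin m), c' i j = c i j)
    (hd : ∀ (i : Fin n) (j : Fin n), d' i j = d i j) (q q' : Fin (m + n)) :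
    appendD m (fun i => appendD m (a' i) (b' i) q') (fun i => appendD m (c' i) (d' i) q') q =
      block a b c d q q' := by
  refine Fin.addCases (fun i => ?_) (fun i => ?_) q <;>
    refine Fin.addCases (fun j => ?_) (fun j => ?_) q' <;>
      simp [appendD, block, ha, hb, hc, hd]

theorem IsComputable.appendD {S X : Type*} [Encodable S] [Encodable X] {n i : X → ℕ}
    {f g : X → ℕ → S} (hn : IsComputable n)
    (hi : IsComputable i) (hf : IsComputable fun x : X × ℕ => f x.1 x.2)
    (hg : IsComputable fun x : X × ℕ => g x.1 x.2) :
    IsComputable fun x => appendD (n x) (f x) (g x) (i x) :=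
  .ite (.lt hi hn) (hf.comp (.pair .id hi)) (hg.comp (.pair .id (.nat_sub hi hn)))

end Blocks

section Automata

open Matrix

variable {k v : ℕ} {S : Type*} [OmegaContinuousSemiring S]

namespace WNKA

/-- Initial weights, indexed by natural numbers. -/
def initD (A : WNKA k v S) (i : ℕ) : S := (List.ofFn A.init).getD i 0

/-- Transition weights, indexed by natural numbers. -/
def transD (A : WNKA k v S) (α β : Packet k v) (i j : ℕ) : S :=
  ((List.ofFn fun q => List.ofFn fun q' => A.trans α β q q').getD i []).getD j 0

/-- Output weights, indexed by natural numbers. -/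
def outD (A : WNKA k v S) (α β : Packet k v) (i : ℕ) : S := (List.ofFn (A.out α β)).getD i 0

theorem getD_ofFn {X : Type*} {n : ℕ} (f : Fin n → X) (q : Fin n) (d : X) :
    (List.ofFn f).getD q d = f q := by
  simp

@[simp] theorem initD_val (A : WNKA k v S) (q : Fin A.n) : A.initD q = A.init q :=
  getD_ofFn _ _ _

@[simp] theorem transD_val (A : WNKA k v S) (α β : Packet k v) (q q' : Fin A.n) :
    A.transD α β q q' = A.trans α β q q' := by
  rw [transD, getD_ofFn, getD_ofFn]

@[simp] theorem outD_val (A : WNKA k v S) (α β : Packet k v) (q : Fin A.n) :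
    A.outD α β q = A.out α β q :=
  getD_ofFn _ _ _

theorem getD_packetTable {X : Type*} (f : Packet k v → X) (α : Packet k v) (d : X) :
    (packetTable f).getD (finFunctionFinEquiv α) d = f α := by
  rw [packetTable, getD_ofFn, Equiv.symm_apply_apply]

end WNKA

namespace WNKA

theorem ofFn_eq_map_range {Y : Type*} {n : ℕ} {f : Fin n → Y} {g : ℕ → Y}
    (h : ∀ i : Fin n, g i = f i) : (List.range n).map g = List.ofFn f := by
  apply List.ext_getElem
  · simp
  · intro i h1 h2
    simpa using h ⟨i, by simpa using h1⟩

theorem sum_range_eq_sum_univ {n : ℕ} {f : Fin n → S} {g : ℕ → S} (h : ∀ i : Fin n, g i = f i) :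
    ∑ i ∈ Finset.range n, g i = ∑ i, f i := by
  rw [← Fin.sum_univ_eq_sum_range]
  exact Finset.sum_congr rfl fun i _ => h i

/-- The entries of the row vector `init × trans α β`. -/
def initTransD (A : WNKA k v S) (α β : Packet k v) (j : ℕ) : S :=
  ∑ i ∈ Finset.range A.n, A.initD i * A.transD α β i j

theorem initTransD_val (A : WNKA k v S) (α β : Packet k v) (q : Fin A.n) :
    A.initTransD α β q = (A.init ᵥ* A.trans α β) q :=
  sum_range_eq_sum_univ fun i => by rw [initD_val, transD_val]

/-- The entries of `heartTrans`, indexed by natural numbers. -/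
def heartTransD (A : WNKA k v S) (α β : Packet k v) (j : ℕ) : S :=
  ∑ γ, A.heartOut α γ * A.initTransD γ β j

theorem heartTransD_val (A : WNKA k v S) (α β : Packet k v) (q : Fin A.n) :
    A.heartTransD α β q = A.heartTrans α β q := by
  simp only [heartTransD, heartTrans, initTransD_val]

/-- One transition of an automaton, on lists of weights. -/
def stepList (A : WNKA k v S) (x : List S × Packet k v) (c : Packet k v) : List S × Packet k v :=
  ((List.range A.n).map fun j =>
    ∑ i ∈ Finset.range A.n, x.1.getD i 0 * A.transD x.2 c i j, c)

theorem run_eq_foldl (A : WNKA k v S) (r : Fin A.n → S) (α β : Packet k v)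
    (l : List (Packet k v)) :
    A.run r α l β = ∑ i ∈ Finset.range A.n, (l.foldl A.stepList (List.ofFn r, α)).1.getD i 0 *
      A.outD (l.foldl A.stepList (List.ofFn r, α)).2 β i := by
  induction l generalizing r α with
  | nil => exact (sum_range_eq_sum_univ fun i => by
      rw [List.foldl_nil, getD_ofFn, outD_val]).symm
  | cons c l ih =>
    have h : A.stepList (List.ofFn r, α) c = (List.ofFn (r ᵥ* A.trans α c), c) :=
      Prod.ext (ofFn_eq_map_range fun q => sum_range_eq_sum_univ fun i => by
        rw [getD_ofFn, transD_val]) rfl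
    rw [List.foldl_cons, h]
    exact ih _ _

variable [Encodable S] {X : Type*} [Encodable X]

theorem isComputable_data {S : Type*} [Encodable S] : IsComputable fun A : WNKA k v S => A.data :=
  ⟨fun n => n, Computable.id, fun _ => rfl⟩

theorem isComputable_n {S : Type*} [Encodable S] {f : X → WNKA k v S} (hf : IsComputable f) :
    IsComputable fun x => (f x).n :=
  .comp (g := fun A : WNKA k v S => A.data.1) (.comp .fst isComputable_data) hf

theorem isComputable_initD {f : X → WNKA k v S} {i : X → ℕ} (hf : IsComputable f)
    (hi : IsComputable i) : IsComputable fun x => (f x).initD (i x) :=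
  .list_getD (.comp (g := fun A : WNKA k v S => A.data.2.1)
    (.comp .fst (.comp .snd isComputable_data)) hf) hi 0

theorem isComputable_transD {f : X → WNKA k v S} (α β : Packet k v) {i j : X → ℕ}
    (hf : IsComputable f) (hi : IsComputable i) (hj : IsComputable j) :
    IsComputable fun x => (f x).transD α β (i x) (j x) := by
  have h : IsComputable fun A : WNKA k v S =>
      ((A.data.2.2.1.getD (finFunctionFinEquiv α) []).getD (finFunctionFinEquiv β) []) :=
    .list_getD (.list_getD (.comp .fst (.comp .snd (.comp .snd isComputable_data)))
      (.const _) []) (.const _) []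
  refine (IsComputable.list_getD (.list_getD (h.comp hf) hi []) hj 0).of_eq fun x => ?_
  rw [data, getD_packetTable, getD_packetTable, transD]

theorem isComputable_outD {f : X → WNKA k v S} (α β : Packet k v) {i : X → ℕ}
    (hf : IsComputable f) (hi : IsComputable i) :
    IsComputable fun x => (f x).outD α β (i x) := by
  have h : IsComputable fun A : WNKA k v S =>
      ((A.data.2.2.2.getD (finFunctionFinEquiv α) []).getD (finFunctionFinEquiv β) []) :=
    .list_getD (.list_getD (.comp .snd (.comp .snd (.comp .snd isComputable_data)))
      (.const _) []) (.const _) []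
  refine (IsComputable.list_getD (h.comp hf) hi 0).of_eq fun x => ?_
  rw [data, getD_packetTable, getD_packetTable, outD]

theorem isComputable_packetTable {Y : Type*} [Encodable Y] {f : Packet k v → X → Y}
    (hf : ∀ α, IsComputable (f α)) : IsComputable fun x => packetTable fun α => f α x :=
  .list_ofFn fun i => hf (finFunctionFinEquiv.symm i)

/-- A function into automata is computable if all components are. -/
theorem isComputable_mk {S : Type*} [Encodable S] {f : X → WNKA k v S} {ι : X → ℕ → S}
    {δ : Packet k v → Packet k v → X → ℕ → ℕ → S} {ω : Packet k v → Packet k v → X → ℕ → S}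
    (hn : IsComputable fun x => (f x).n)
    (hι : IsComputable fun y : X × ℕ => ι y.1 y.2)
    (hδ : ∀ α β, IsComputable fun y : X × ℕ × ℕ => δ α β y.1 y.2.1 y.2.2)
    (hω : ∀ α β, IsComputable fun y : X × ℕ => ω α β y.1 y.2)
    (eι : ∀ x (q : Fin (f x).n), ι x q = (f x).init q)
    (eδ : ∀ α β x (q q' : Fin (f x).n), δ α β x q q' = (f x).trans α β q q')
    (eω : ∀ α β x (q : Fin (f x).n), ω α β x q = (f x).out α β q) : IsComputable f := by
  have h1 : IsComputable fun x => List.ofFn (f x).init :=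
    (IsComputable.list_tabulate hn hι).of_eq fun x => ofFn_eq_map_range (eι x)
  have h2 : ∀ α β, IsComputable fun x =>
      List.ofFn fun q => List.ofFn fun q' => (f x).trans α β q q' := fun α β =>
    (IsComputable.list_tabulate (f := fun x i => (List.range (f x).n).map (δ α β x i)) hn
      (IsComputable.list_tabulate (f := fun (y : X × ℕ) j => δ α β y.1 y.2 j) (hn.comp .fst)
        ((hδ α β).comp (.pair (.comp .fst .fst) (.pair (.comp .snd .fst) .snd))))).of_eq
      fun x => ofFn_eq_map_range fun q => ofFn_eq_map_range fun q' => eδ α β x q q'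
  have h3 : ∀ α β, IsComputable fun x => List.ofFn ((f x).out α β) := fun α β =>
    (IsComputable.list_tabulate hn (hω α β)).of_eq fun x => ofFn_eq_map_range (eω α β x)
  have h : IsComputable fun x => (f x).data :=
    .pair hn (.pair h1 (.pair
      (isComputable_packetTable fun α => isComputable_packetTable fun β => h2 α β)
      (isComputable_packetTable fun α => isComputable_packetTable fun β => h3 α β)))
  exact h.of_encode_eq fun x => rfl

theorem isComputable_weigh (hS : IsComputableSemiring S) :
    IsComputable fun x : S × WNKA k v S => weigh x.1 x.2 :=
  isComputable_mk (ι := fun x i => x.1 * x.2.initD i) (δ := fun α β x => x.2.transD α β)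
    (ω := fun α β x => x.2.outD α β)
    (isComputable_n (f := fun x : S × WNKA k v S => x.2) .snd)
    (hS.mul' (.comp .fst .fst) (isComputable_initD (.comp .snd .fst) .snd))
    (fun α β => isComputable_transD α β (.comp .snd .fst) (.comp .fst .snd) (.comp .snd .snd))
    (fun α β => isComputable_outD α β (.comp .snd .fst) .snd)
    (fun x q => congrArg (x.1 * ·) (x.2.initD_val q))
    (fun α β x q q' => x.2.transD_val α β q q') (fun α β x q => x.2.outD_val α β q)

theorem isComputable_choice :
    IsComputable fun x : WNKA k v S × WNKA k v S => choice x.1 x.2 :=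
  isComputable_mk
    (ι := fun x => appendD x.1.n x.1.initD x.2.initD)
    (δ := fun α β x i j => appendD x.1.n
      (fun i => appendD x.1.n (x.1.transD α β i) (fun _ => 0) j)
      (fun i => appendD x.1.n (fun _ => 0) (x.2.transD α β i) j) i)
    (ω := fun α β x => appendD x.1.n (x.1.outD α β) (x.2.outD α β))
    (.nat_add (isComputable_n .fst) (isComputable_n .snd))
    (.appendD (isComputable_n (.comp .fst .fst)) .snd
      (isComputable_initD (.comp .fst (.comp .fst .fst)) .snd)
      (isComputable_initD (.comp .snd (.comp .fst .fst)) .snd))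
    (fun α β => .appendD (isComputable_n (.comp .fst .fst)) (.comp .fst .snd)
      (.appendD (isComputable_n (.comp .fst (.comp .fst .fst))) (.comp .snd (.comp .snd .fst))
        (isComputable_transD α β (.comp .fst (.comp .fst (.comp .fst .fst))) (.comp .snd .fst) .snd)
        (.const 0))
      (.appendD (isComputable_n (.comp .fst (.comp .fst .fst))) (.comp .snd (.comp .snd .fst))
        (.const 0)
        (isComputable_transD α β (.comp .snd (.comp .fst (.comp .fst .fst))) (.comp .snd .fst)
          .snd)))
    (fun α β => .appendD (isComputable_n (.comp .fst .fst)) .snd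
      (isComputable_outD α β (.comp .fst (.comp .fst .fst)) .snd)
      (isComputable_outD α β (.comp .snd (.comp .fst .fst)) .snd))
    (fun x q => appendD_val x.1.initD_val x.2.initD_val q)
    (fun α β x q q' => blockD_val (x.1.transD_val α β) (fun _ _ => rfl) (fun _ _ => rfl)
      (x.2.transD_val α β) q q')
    (fun α β x q => appendD_val (x.1.outD_val α β) (x.2.outD_val α β) q)

theorem isComputable_initTransD (hS : IsComputableSemiring S) {f : X → WNKA k v S}
    (α β : Packet k v) {i : X → ℕ} (hf : IsComputable f) (hi : IsComputable i) :
    IsComputable fun x => (f x).initTransD α β (i x) :=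
  hS.sum_range (isComputable_n hf) (hS.mul' (isComputable_initD (.comp hf .fst) .snd)
    (isComputable_transD α β (.comp hf .fst) .snd (.comp hi .fst)))

theorem isComputable_init_dotProduct_out (hS : IsComputableSemiring S) (α β : Packet k v) :
    IsComputable fun A : WNKA k v S => A.init ⬝ᵥ A.out α β :=
  (hS.sum_range (f := fun A i => A.initD i * A.outD α β i) (isComputable_n .id)
    (hS.mul' (isComputable_initD .fst .snd)
    (isComputable_outD α β .fst .snd))).of_eq fun A =>
      sum_range_eq_sum_univ fun i => by rw [initD_val, outD_val]

theorem isComputable_seq (hS : IsComputableSemiring S) :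
    IsComputable fun x : WNKA k v S × WNKA k v S => seq x.1 x.2 :=
  isComputable_mk
    (ι := fun x => appendD x.1.n x.1.initD fun _ => 0)
    (δ := fun α β x i j => appendD x.1.n
      (fun i => appendD x.1.n (x.1.transD α β i)
        (fun j => ∑ γ, x.1.outD α γ i * x.2.initTransD γ β j) j)
      (fun i => appendD x.1.n (fun _ => 0) (x.2.transD α β i) j) i)
    (ω := fun α β x => appendD x.1.n
      (fun i => ∑ γ, x.1.outD α γ i * (x.2.init ⬝ᵥ x.2.out γ β)) (x.2.outD α β))
    (.nat_add (isComputable_n .fst) (isComputable_n .snd))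
    (.appendD (isComputable_n (.comp .fst .fst)) .snd
      (isComputable_initD (.comp .fst (.comp .fst .fst)) .snd) (.const 0))
    (fun α β => .appendD (isComputable_n (.comp .fst .fst)) (.comp .fst .snd)
      (.appendD (isComputable_n (.comp .fst (.comp .fst .fst))) (.comp .snd (.comp .snd .fst))
        (isComputable_transD α β (.comp .fst (.comp .fst (.comp .fst .fst))) (.comp .snd .fst) .snd)
        (hS.sum _ fun γ => hS.mul'
          (isComputable_outD α γ (.comp .fst (.comp .fst (.comp .fst .fst))) (.comp .snd .fst))
          (isComputable_initTransD hS γ β (.comp .snd (.comp .fst (.comp .fst .fst))) .snd)))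
      (.appendD (isComputable_n (.comp .fst (.comp .fst .fst))) (.comp .snd (.comp .snd .fst))
        (.const 0)
        (isComputable_transD α β (.comp .snd (.comp .fst (.comp .fst .fst))) (.comp .snd .fst)
          .snd)))
    (fun α β => .appendD (isComputable_n (.comp .fst .fst)) .snd
      (hS.sum _ fun γ => hS.mul' (isComputable_outD α γ (.comp .fst (.comp .fst .fst)) .snd)
        ((isComputable_init_dotProduct_out hS γ β).comp (.comp .snd (.comp .fst .fst))))
      (isComputable_outD α β (.comp .snd (.comp .fst .fst)) .snd))
    (fun x q => appendD_val x.1.initD_val (fun _ => rfl) q)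
    (fun α β x q q' => blockD_val (x.1.transD_val α β) (fun i j => by
        simp only [Matrix.sum_apply, vecMulVec_apply, outD_val, initTransD_val])
      (fun _ _ => rfl) (x.2.transD_val α β) q q')
    (fun α β x q => appendD_val
      (f := fun q => ∑ γ, x.1.out α γ q * (x.2.init ⬝ᵥ x.2.out γ β))
      (fun i => by simp only [outD_val]) (x.2.outD_val α β) q)

theorem isComputable_heartOut (hS : IsComputableSemiring S) (α β : Packet k v) :
    IsComputable fun A : WNKA k v S => A.heartOut α β :=
  hS.matStar (fun α β => isComputable_init_dotProduct_out hS α β) α β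

theorem isComputable_heartTransD (hS : IsComputableSemiring S) {f : X → WNKA k v S}
    (α β : Packet k v) {i : X → ℕ} (hf : IsComputable f) (hi : IsComputable i) :
    IsComputable fun x => (f x).heartTransD α β (i x) :=
  hS.sum _ fun γ => hS.mul' ((isComputable_heartOut hS α γ).comp hf)
    (isComputable_initTransD hS γ β hf hi)

theorem isComputable_star (hS : IsComputableSemiring S) :
    IsComputable fun A : WNKA k v S => star A :=
  isComputable_mk
    (ι := fun A => appendD A.n (fun _ => 0) fun _ => 1)
    (δ := fun α β A i j => appendD A.n
      (fun i => appendD A.n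
        (fun j => A.transD α β i j + ∑ γ, A.outD α γ i * A.heartTransD γ β j) (fun _ => 0) j)
      (fun _ => appendD A.n (fun j => A.heartTransD α β j) (fun _ => 0) j) i)
    (ω := fun α β A => appendD A.n
      (fun i => ∑ γ, A.outD α γ i * A.heartOut γ β) (fun _ => A.heartOut α β))
    (.nat_add (isComputable_n .id) (.const 1))
    (.appendD (isComputable_n .fst) .snd (.const 0) (.const 1))
    (fun α β => .appendD (isComputable_n .fst) (.comp .fst .snd)
      (.appendD (isComputable_n (.comp .fst .fst)) (.comp .snd (.comp .snd .fst))
        (hS.add' (isComputable_transD α β (.comp .fst (.comp .fst .fst)) (.comp .snd .fst) .snd)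
          (hS.sum _ fun γ => hS.mul'
            (isComputable_outD α γ (.comp .fst (.comp .fst .fst)) (.comp .snd .fst))
            (isComputable_heartTransD hS γ β (.comp .fst (.comp .fst .fst)) .snd)))
        (.const 0))
      (.appendD (isComputable_n (.comp .fst .fst)) (.comp .snd (.comp .snd .fst))
        (isComputable_heartTransD hS α β (.comp .fst (.comp .fst .fst)) .snd) (.const 0)))
    (fun α β => .appendD (isComputable_n .fst) .snd
      (hS.sum _ fun γ => hS.mul' (isComputable_outD α γ (.comp .fst .fst) .snd)
        ((isComputable_heartOut hS γ β).comp (.comp .fst .fst)))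
      ((isComputable_heartOut hS α β).comp (.comp .fst .fst)))
    (fun x q => appendD_val (fun _ => rfl) (fun _ => rfl) q)
    (fun α β x q q' => blockD_val (fun i j => by
        simp only [Matrix.add_apply, Matrix.sum_apply, vecMulVec_apply, outD_val, transD_val,
          heartTransD_val])
      (fun _ _ => rfl) (fun _ j => heartTransD_val x α β j) (fun _ _ => rfl) q q')
    (fun α β x q => appendD_val (f := fun q => ∑ γ, x.out α γ q * x.heartOut γ β)
      (g := fun _ => x.heartOut α β) (g' := fun _ => x.heartOut α β)
      (fun i => by simp only [outD_val]) (fun _ => rfl) q)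

theorem isComputable_stepList (hS : IsComputableSemiring S) :
    IsComputable fun x : WNKA k v S × (List S × Packet k v) × Packet k v =>
      stepList x.1 x.2.1 x.2.2 := by
  refine .pair (.list_tabulate (isComputable_n .fst) (hS.sum_range
    (isComputable_n (.comp .fst .fst))
    (hS.mul' (.list_getD (.comp .fst (.comp .fst (.comp .snd (.comp .fst .fst)))) .snd 0) ?_)))
    (.comp .snd .snd)
  refine .finite_cases (f := fun α
    (x : ((WNKA k v S × (List S × Packet k v) × Packet k v) × ℕ) × ℕ)
    => x.1.1.1.transD α x.1.1.2.2 x.2 x.1.2)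
    (.comp .snd (.comp .fst (.comp .snd (.comp .fst .fst)))) fun α => ?_
  exact .finite_cases (f := fun β
    (x : ((WNKA k v S × (List S × Packet k v) × Packet k v) × ℕ) × ℕ)
    => x.1.1.1.transD α β x.2 x.1.2) (.comp .snd (.comp .snd (.comp .fst .fst))) fun β =>
      isComputable_transD α β (.comp .fst (.comp .fst .fst)) .snd (.comp .snd .fst)

theorem isComputable_init {S : Type*} [Encodable S] :
    IsComputable fun A : WNKA k v S => List.ofFn A.init :=
  .comp (g := fun x : List S × List (List (List (List S))) × List (List (List S)) => x.1) .fst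
    (.comp .snd isComputable_data)

theorem isComputable_foldl_stepList (hS : IsComputableSemiring S) :
    IsComputable fun x : WNKA k v S × GuardedString k v =>
      x.2.2.1.foldl x.1.stepList (List.ofFn x.1.init, x.2.1) := by
  have hs : IsComputable fun x : WNKA k v S × GuardedString k v => (List.ofFn x.1.init, x.2.1) :=
    .pair (isComputable_init.comp .fst) (.comp .fst .snd)
  have hl : IsComputable fun x : WNKA k v S × GuardedString k v => x.2.2.1 :=
    .comp .fst (.comp .snd .snd)
  have hx : IsComputable fun y : (WNKA k v S × GuardedString k v) ×
      (List S × Packet k v) × Packet k v => (y.1.1, y.2) := .pair (.comp .fst .fst) .snd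
  have hh : IsComputable fun y : (WNKA k v S × GuardedString k v) ×
      (List S × Packet k v) × Packet k v => stepList y.1.1 y.2.1 y.2.2 := by
    have := IsComputable.comp (isComputable_stepList (k := k) (v := v) hS) hx
    exact this
  exact IsComputable.list_foldl (h := fun x : WNKA k v S × GuardedString k v => stepList x.1)
    hl hs hh

theorem isComputable_outD_packets :
    IsComputable fun x : (WNKA k v S × Packet k v × Packet k v) × ℕ =>
      x.1.1.outD x.1.2.1 x.1.2.2 x.2 :=
  .finite_cases (f := fun α (x : (WNKA k v S × Packet k v × Packet k v) × ℕ) =>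
    x.1.1.outD α x.1.2.2 x.2) (.comp .fst (.comp .snd .fst)) fun α =>
    .finite_cases (f := fun β (x : (WNKA k v S × Packet k v × Packet k v) × ℕ) =>
      x.1.1.outD α β x.2) (.comp .snd (.comp .snd .fst)) fun β =>
      isComputable_outD α β (.comp .fst .fst) .snd

theorem isComputable_sem (hS : IsComputableSemiring S) :
    IsComputable fun x : WNKA k v S × GuardedString k v => x.1.sem x.2 := by
  obtain ⟨F, hF, hF'⟩ : ∃ F : WNKA k v S × GuardedString k v → List S × Packet k v,
      IsComputable F ∧ ∀ x, F x = x.2.2.1.foldl x.1.stepList (List.ofFn x.1.init, x.2.1) :=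
    ⟨_, isComputable_foldl_stepList hS, fun _ => rfl⟩
  have hget : IsComputable fun y : (WNKA k v S × GuardedString k v) × ℕ => (F y.1).1.getD y.2 0 :=
    .list_getD (.comp .fst (hF.comp .fst)) .snd 0
  have harg : IsComputable fun y : (WNKA k v S × GuardedString k v) × ℕ =>
      ((y.1.1, (F y.1).2, y.1.2.2.2), y.2) :=
    .pair (.pair (.comp .fst .fst) (.pair (.comp .snd (hF.comp .fst))
      (.comp .snd (.comp .snd (.comp .snd .fst))))) .snd
  have hout : IsComputable fun y : (WNKA k v S × GuardedString k v) × ℕ =>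
      y.1.1.outD (F y.1).2 y.1.2.2.2 y.2 :=
    isComputable_outD_packets.comp harg
  have hsum : IsComputable fun x : WNKA k v S × GuardedString k v =>
      ∑ i ∈ Finset.range x.1.n, (F x).1.getD i 0 * x.1.outD (F x).2 x.2.2.2 i :=
    hS.sum_range (f := fun x i => (F x).1.getD i 0 * x.1.outD (F x).2 x.2.2.2 i)
      (isComputable_n .fst) (hS.mul' hget hout)
  refine hsum.of_eq fun x => ?_
  rw [hF']
  exact (run_eq_foldl x.1 x.1.init x.2.1 x.2.2.2 x.2.2.1).symm

end WNKA

end Automata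

section Compilation

variable {k v : ℕ} {S : Type*} [Encodable S]

/-- Predicates are coded by their Gödel numbers. -/
noncomputable instance : Encodable (Pred k v) := Encodable.ofInj _ Pred.code_injective

theorem encode_pred (t : Pred k v) : encode t = t.code := rfl

theorem right_lt_pair {a b : ℕ} (ha : 0 < a) : b < Nat.pair a b :=
  lt_of_lt_of_le (Nat.lt_add_of_pos_left ha) (Nat.add_le_pair a b)

theorem fst_lt_pair {a b c : ℕ} (ha : 0 < a) : b < Nat.pair a (Nat.pair b c) :=
  (Nat.left_le_pair b c).trans_lt (right_lt_pair ha)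

theorem snd_lt_pair {a b c : ℕ} (ha : 0 < a) : c < Nat.pair a (Nat.pair b c) :=
  (Nat.right_le_pair b c).trans_lt (right_lt_pair ha)

theorem isComputable_pred_sem (π : Packet k v) : IsComputable fun t : Pred k v => t.sem π := by
  obtain ⟨T, hT, hT'⟩ := IsComputable.of_finite fun x : Fin k × Fin v => decide (π x.1 = x.2)
  obtain ⟨O, hO, hO'⟩ := IsComputable.of_finite fun x : Bool × Bool => x.1 || x.2
  obtain ⟨A, hA, hA'⟩ := IsComputable.of_finite fun x : Bool × Bool => x.1 && x.2
  obtain ⟨N, hN, hN'⟩ := IsComputable.of_finite fun x : Bool => !x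
  have harg : Computable fun x : ℕ × ℕ × ℕ × ℕ × ℕ => x.2.1 := Computable.fst.comp Computable.snd
  have hL : Computable fun x : ℕ × ℕ × ℕ × ℕ × ℕ => x.2.2.1 :=
    Computable.fst.comp (Computable.snd.comp Computable.snd)
  have hLL : Computable fun x : ℕ × ℕ × ℕ × ℕ × ℕ => Nat.pair x.2.2.2.1 x.2.2.2.2 :=
    Primrec₂.natPair.to_comp.comp
      (Computable.fst.comp (Computable.snd.comp (Computable.snd.comp Computable.snd)))
      (Computable.snd.comp (Computable.snd.comp (Computable.snd.comp Computable.snd)))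
  refine IsComputable.of_code_rec (fun x => if x.1 = 0 then 0 else if x.1 = 1 then 1 else
    if x.1 = 2 then T x.2.1 else if x.1 = 3 then O (Nat.pair x.2.2.2.1 x.2.2.2.2) else
    if x.1 = 4 then A (Nat.pair x.2.2.2.1 x.2.2.2.2) else N x.2.2.1)
    (.ite_tag (.const _) (.ite_tag (.const _) (.ite_tag (hT.comp harg) (.ite_tag (hO.comp hLL)
      (.ite_tag (hA.comp hLL) (hN.comp hL) _) _) _) _) _) fun t L hL => ?_
  cases t with
  | ff => simp [encode_pred, Pred.code, Pred.sem]
  | tt => simp [encode_pred, Pred.code, Pred.sem]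
  | test f n =>
    simp only [encode_pred, Pred.code, Nat.unpair_pair, Pred.sem]
    exact hT' (f, n)
  | or t u =>
    have ht := hL t (fst_lt_pair (by norm_num))
    have hu := hL u (snd_lt_pair (by norm_num))
    simp only [encode_pred] at ht hu
    simp only [encode_pred, Pred.code, Nat.unpair_pair, Pred.sem, ht, hu]
    exact hO' (t.sem π, u.sem π)
  | and t u =>
    have ht := hL t (fst_lt_pair (by norm_num))
    have hu := hL u (snd_lt_pair (by norm_num))
    simp only [encode_pred] at ht hu
    simp only [encode_pred, Pred.code, Nat.unpair_pair, Pred.sem, ht, hu]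
    exact hA' (t.sem π, u.sem π)
  | not t =>
    have ht := hL t (right_lt_pair (by norm_num))
    simp only [encode_pred] at ht
    simp only [encode_pred, Pred.code, Nat.unpair_pair, Pred.sem, ht]
    exact hN' (t.sem π)

/-- The function on codes that is computed by recursion on (reduced) policies. -/
def policyStep (g₀ g₁ g₃ g₄ g₅ g₆ : ℕ → ℕ) (c₂ : ℕ) (x : ℕ × ℕ × ℕ × ℕ × ℕ) : ℕ :=
  if x.1 = 0 then g₀ x.2.1 else if x.1 = 1 then g₁ x.2.1 else if x.1 = 2 then c₂ else
  if x.1 = 3 then g₃ (Nat.pair x.2.2.2.1 x.2.2.2.2) else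
  if x.1 = 4 then g₄ (Nat.pair x.2.1.unpair.1 x.2.2.2.2) else
  if x.1 = 5 then g₅ (Nat.pair x.2.2.2.1 x.2.2.2.2) else g₆ x.2.2.1

theorem computable_policyStep {g₀ g₁ g₃ g₄ g₅ g₆ : ℕ → ℕ} (h₀ : Computable g₀)
    (h₁ : Computable g₁) (h₃ : Computable g₃) (h₄ : Computable g₄) (h₅ : Computable g₅)
    (h₆ : Computable g₆) (c₂ : ℕ) : Computable (policyStep g₀ g₁ g₃ g₄ g₅ g₆ c₂) := by
  have harg : Computable fun x : ℕ × ℕ × ℕ × ℕ × ℕ => x.2.1 := Computable.fst.comp Computable.snd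
  have hL : Computable fun x : ℕ × ℕ × ℕ × ℕ × ℕ => x.2.2.1 :=
    Computable.fst.comp (Computable.snd.comp Computable.snd)
  have hL₁ : Computable fun x : ℕ × ℕ × ℕ × ℕ × ℕ => x.2.2.2.1 :=
    Computable.fst.comp (Computable.snd.comp (Computable.snd.comp Computable.snd))
  have hL₂ : Computable fun x : ℕ × ℕ × ℕ × ℕ × ℕ => x.2.2.2.2 :=
    Computable.snd.comp (Computable.snd.comp (Computable.snd.comp Computable.snd))
  have hLL := Primrec₂.natPair.to_comp.comp hL₁ hL₂
  have hAL := Primrec₂.natPair.to_comp.comp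
    (Computable.fst.comp (Computable.unpair.comp harg)) hL₂
  exact .ite_tag (h₀.comp harg) (.ite_tag (h₁.comp harg) (.ite_tag (.const _)
    (.ite_tag (h₃.comp hLL) (.ite_tag (h₄.comp hAL) (.ite_tag (h₅.comp hLL) (h₆.comp hL)
      _) _) _) _) _) _

theorem isComputable_policy_rec {β : Type*} [Encodable β] {f : Policy k v S → β}
    {seq choice : β × β → β} {weigh : S × β → β} {star : β → β}
    (hfilter : IsComputable fun t => f (.filter t))
    (hassign : IsComputable fun x : Fin k × Fin v => f (.assign x.1 x.2))
    (hseq : IsComputable seq) (hweigh : IsComputable weigh) (hchoice : IsComputable choice)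
    (hstar : IsComputable star)
    (eseq : ∀ p q, f (.seq p q) = seq (f p, f q)) (eweigh : ∀ s p, f (.weigh s p) = weigh (s, f p))
    (echoice : ∀ p q, f (.choice p q) = choice (f p, f q))
    (estar : ∀ p, f (.star p) = star (f p)) : IsComputable f := by
  obtain ⟨g₀, h₀, e₀⟩ := hfilter
  obtain ⟨g₁, h₁, e₁⟩ := hassign
  obtain ⟨g₃, h₃, e₃⟩ := hseq
  obtain ⟨g₄, h₄, e₄⟩ := hweigh
  obtain ⟨g₅, h₅, e₅⟩ := hchoice
  obtain ⟨g₆, h₆, e₆⟩ := hstar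
  refine IsComputable.of_code_rec _
    (computable_policyStep h₀ h₁ h₃ h₄ h₅ h₆ (encode (f .dup))) fun t L hL => ?_
  cases t with
  | filter t =>
    have h : g₀ t.code = encode (f (.filter t)) := e₀ t
    simpa [encode_policy, Policy.code, policyStep] using h
  | assign m n =>
    have h : g₁ (Nat.pair m n) = encode (f (.assign m n)) := e₁ (m, n)
    simpa [encode_policy, Policy.code, policyStep] using h
  | dup => simp [encode_policy, Policy.code, policyStep]
  | seq p q =>
    have hp := hL p (fst_lt_pair (by norm_num))
    have hq := hL q (snd_lt_pair (by norm_num))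
    simp only [encode_policy] at hp hq
    simpa [encode_policy, Policy.code, policyStep, hp, hq, eseq] using e₃ (f p, f q)
  | weigh s p =>
    have hp := hL p (snd_lt_pair (by norm_num))
    simp only [encode_policy] at hp
    simpa [encode_policy, Policy.code, policyStep, hp, eweigh] using e₄ (s, f p)
  | choice p q =>
    have hp := hL p (fst_lt_pair (by norm_num))
    have hq := hL q (snd_lt_pair (by norm_num))
    simp only [encode_policy] at hp hq
    simpa [encode_policy, Policy.code, policyStep, hp, hq, echoice] using e₅ (f p, f q)
  | star p =>
    have hp := hL p (right_lt_pair (by norm_num))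
    simp only [encode_policy] at hp
    simpa [encode_policy, Policy.code, policyStep, hp, estar] using e₆ (f p)

theorem isComputable_rpolicy_rec {β : Type*} [Encodable β] {f : RPolicy k v S → β}
    {seq choice : β × β → β} {weigh : S × β → β} {star : β → β}
    (hseq : IsComputable seq) (hweigh : IsComputable weigh) (hchoice : IsComputable choice)
    (hstar : IsComputable star)
    (eseq : ∀ p q, f (.seq p q) = seq (f p, f q)) (eweigh : ∀ s p, f (.weigh s p) = weigh (s, f p))
    (echoice : ∀ p q, f (.choice p q) = choice (f p, f q))
    (estar : ∀ p, f (.star p) = star (f p)) : IsComputable f := by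
  obtain ⟨g₀, h₀, e₀⟩ := IsComputable.of_finite fun π => f (.ctest π)
  obtain ⟨g₁, h₁, e₁⟩ := IsComputable.of_finite fun π => f (.cassign π)
  obtain ⟨g₃, h₃, e₃⟩ := hseq
  obtain ⟨g₄, h₄, e₄⟩ := hweigh
  obtain ⟨g₅, h₅, e₅⟩ := hchoice
  obtain ⟨g₆, h₆, e₆⟩ := hstar
  refine IsComputable.of_code_rec _
    (computable_policyStep h₀ h₁ h₃ h₄ h₅ h₆ (encode (f .dup))) fun t L hL => ?_
  cases t with
  | ctest π => simpa [encode_rpolicy, RPolicy.code, policyStep] using e₀ π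
  | cassign π => simpa [encode_rpolicy, RPolicy.code, policyStep] using e₁ π
  | dup => simp [encode_rpolicy, RPolicy.code, policyStep]
  | seq p q =>
    have hp := hL p (fst_lt_pair (by norm_num))
    have hq := hL q (snd_lt_pair (by norm_num))
    simp only [encode_rpolicy] at hp hq
    simpa [encode_rpolicy, RPolicy.code, policyStep, hp, hq, eseq] using e₃ (f p, f q)
  | weigh s p =>
    have hp := hL p (snd_lt_pair (by norm_num))
    simp only [encode_rpolicy] at hp
    simpa [encode_rpolicy, RPolicy.code, policyStep, hp, eweigh] using e₄ (s, f p)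
  | choice p q =>
    have hp := hL p (fst_lt_pair (by norm_num))
    have hq := hL q (snd_lt_pair (by norm_num))
    simp only [encode_rpolicy] at hp hq
    simpa [encode_rpolicy, RPolicy.code, policyStep, hp, hq, echoice] using e₅ (f p, f q)
  | star p =>
    have hp := hL p (right_lt_pair (by norm_num))
    simp only [encode_rpolicy] at hp
    simpa [encode_rpolicy, RPolicy.code, policyStep, hp, estar] using e₆ (f p)

theorem isComputable_node {β γ : Type*} [Encodable β] [Encodable γ] {f : β → γ → RPolicy k v S}
    (t : ℕ) (hf : ∀ b c, (f b c).code = Nat.pair t (Nat.pair (encode b) (encode c))) :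
    IsComputable fun x : β × γ => f x.1 x.2 :=
  ⟨fun n => Nat.pair t n, Primrec₂.natPair.to_comp.comp (Computable.const _) Computable.id,
    fun x => by rw [encode_rpolicy, hf, encode_prod_val]⟩

variable [OmegaContinuousSemiring S]

/-- Compilation of reduced policies to automata is computable. -/
theorem isComputable_thompson (hS : IsComputableSemiring S) :
    IsComputable (RPolicy.thompson : RPolicy k v S → WNKA k v S) :=
  isComputable_rpolicy_rec (seq := fun x => WNKA.seq x.1 x.2)
    (choice := fun x => WNKA.choice x.1 x.2)
    (weigh := fun x => WNKA.weigh x.1 x.2) (star := WNKA.star) (WNKA.isComputable_seq hS)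
    (WNKA.isComputable_weigh hS) WNKA.isComputable_choice (WNKA.isComputable_star hS)
    (fun _ _ => rfl) (fun _ _ => rfl) (fun _ _ => rfl) (fun _ => rfl)

theorem isComputable_rpolicy_sum {X : Type*} [Encodable X] (L : List (Packet k v))
    {f : Packet k v → X → RPolicy k v S} (hf : ∀ π, IsComputable (f π)) :
    IsComputable fun x => RPolicy.sum (L.map fun π => f π x) := by
  unfold RPolicy.sum
  induction L with
  | nil => exact .const _
  | cons π L ih =>
    cases L with
    | nil => exact hf π
    | cons π' L =>
      exact (isComputable_node (f := RPolicy.choice) 5 fun _ _ => rfl).comp ((hf π).pair ih)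

/-- Reduction of policies is computable. -/
theorem isComputable_reduce :
    IsComputable (Policy.reduce : Policy k v S → RPolicy k v S) := by
  refine isComputable_policy_rec (seq := fun x => RPolicy.seq x.1 x.2)
    (choice := fun x => RPolicy.choice x.1 x.2) (weigh := fun x => RPolicy.weigh x.1 x.2)
    (star := RPolicy.star) ?_ (.of_finite _) (isComputable_node 3 fun _ _ => rfl)
    (isComputable_node 4 fun _ _ => rfl) (isComputable_node 5 fun _ _ => rfl)
    ⟨fun n => Nat.pair 6 n, Primrec₂.natPair.to_comp.comp (.const _) .id, fun _ => rfl⟩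
    (fun _ _ => rfl) (fun _ _ => rfl) (fun _ _ => rfl) (fun _ => rfl)
  refine isComputable_rpolicy_sum _ fun π =>
    (isComputable_node (f := RPolicy.weigh) 4 fun _ _ => rfl).comp (.pair ?_ (.const _))
  exact (IsComputable.of_finite fun b : Bool => iverson S (b = true)).comp
    (isComputable_pred_sem π)

/-- The semantics of policies is computable. -/
theorem isComputable_policy_sem (hS : IsComputableSemiring S) :
    IsComputable fun x : Policy k v S × History k v × History k v => x.1.sem x.2.1 x.2.2 := by
  have hh : IsComputable fun x : Policy k v S × History k v × History k v => x.2.1 :=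
    .comp .fst .snd
  have hh' : IsComputable fun x : Policy k v S × History k v × History k v => x.2.2 :=
    .comp .snd .snd
  have ht : IsComputable fun x : Policy k v S × History k v × History k v => x.2.1.2 :=
    .comp .snd hh
  have ht' : IsComputable fun x : Policy k v S × History k v × History k v => x.2.2.2 :=
    .comp .snd hh'
  have hn : IsComputable fun x : Policy k v S × History k v × History k v =>
      x.2.2.2.length - x.2.1.2.length :=
    .nat_sub (IsComputable.list_length.comp ht') (IsComputable.list_length.comp ht)
  have hA : IsComputable fun x : Policy k v S × History k v × History k v =>
      x.1.reduce.thompson :=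
    (isComputable_thompson hS).comp (isComputable_reduce.comp .fst)
  have harg : IsComputable fun x : Policy k v S × History k v × History k v =>
      (x.1.reduce.thompson, (x.2.1.1,
        (x.2.2.2.take (x.2.2.2.length - x.2.1.2.length)).reverse, x.2.2.1)) :=
    .pair hA (.pair (.comp .fst hh) (.pair (IsComputable.list_reverse.comp (.list_take ht' hn))
      (.comp .fst hh')))
  have hsem := IsComputable.comp (WNKA.isComputable_sem (k := k) (v := v) hS) harg
  have hdec : IsComputable fun x : Policy k v S × History k v × History k v =>
      decide (x.2.1.2 = x.2.2.2.drop (x.2.2.2.length - x.2.1.2.length)) :=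
    .decide_eq ht (.list_drop ht' hn)
  exact (IsComputable.ite hdec hsem (.const 0)).of_eq fun x => (x.1.sem_eq_thompson _ _).symm

end Compilation

end WNetKAT

theorem mainTheorem6 (k v : ℕ) (S : Type*) [WNetKAT.OmegaContinuousSemiring S] [Encodable S]
    (hS : WNetKAT.IsComputableSemiring S) :
    -- reducing policies and compiling reduced policies to automata are computable
    WNetKAT.IsComputable (WNetKAT.Policy.reduce : WNetKAT.Policy k v S → WNetKAT.RPolicy k v S) ∧
    WNetKAT.IsComputable
      (WNetKAT.RPolicy.thompson : WNetKAT.RPolicy k v S → WNetKAT.WNKA k v S) ∧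
    -- evaluating automata is computable
    WNetKAT.IsComputable
      (fun x : WNetKAT.WNKA k v S × WNetKAT.GuardedString k v => x.1.sem x.2) ∧
    -- reduction preserves the semantics, and the automaton of a policy computes its semantics
    (∀ p : WNetKAT.Policy k v S, p.reduce.toPolicy.sem = p.sem) ∧
    (∀ (p : WNetKAT.RPolicy k v S) (α β : WNetKAT.Packet k v) (l t : List (WNetKAT.Packet k v)),
      p.toPolicy.sem (α, t) (β, l.reverse ++ t) = p.thompson.sem (α, l, β)) ∧
    (∀ (p : WNetKAT.Policy k v S) (h h' : WNetKAT.History k v),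
      ¬ h.2 <:+ h'.2 → p.sem h h' = 0) ∧
    -- the semantics is computable, uniformly in the policy
    WNetKAT.IsComputable
      (fun x : WNetKAT.Policy k v S × WNetKAT.History k v × WNetKAT.History k v =>
        x.1.sem x.2.1 x.2.2) :=
  ⟨WNetKAT.isComputable_reduce, WNetKAT.isComputable_thompson hS,
    WNetKAT.WNKA.isComputable_sem hS, WNetKAT.Policy.sem_reduce,
    fun p α β l t => p.isLocal.apply α β l t, fun p _ _ hh => p.sem_eq_zero hh,
    WNetKAT.isComputable_policy_sem hS⟩
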